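/- Let $k\ge 1$, let $X$ and $Y_1,\dots,Y_k$ be real Hilbert spaces, let $g_i:Y_i\to\overline{\mathbb R}=\mathbb R\cup\{\pm\infty\}$ be proper, convex and lower semicontinuous, let $K_i:X\to Y_i$ be continuous linear operators with adjoints $K_i^*$, and let $\omega_i\in(0,1]$ $(i=1,\dots,k)$ with $\sum_{i=1}^k\omega_i=1$. Write $\operatorname{dom} g=\{y: g(y)<+\infty\}$, $g^*(u)=\sup_{y}\{\langle u,y\rangle-g(y)\}$ for the conjugate, $\partial$ for the convex subdifferential, and, for a convex set $C$, $\operatorname{sqri} C=\{c\in C:\bigcup_{\lambda>0}\lambda(C-c)\text{ is a closed linear subspace}\}$. For $\gamma>0$, $\operatorname{prox}_{\gamma f}(x)$ denotes the unique minimizer of $y\mapsto f(y)+\frac1{2\gamma}\|y-x\|^2$. Consider the primal problem $$(P)\quad \inf_{x\in X}\ \sum_{i=1}^k\omega_i\, g_i(K_ix)$$ and its Fenchel-type dual $$(D)\quad \sup\Big\{\sum_{i=1}^k-\omega_i\, g_i^*(y_i)\ :\ y_i\in Y_i,\ \sum_{i=1}^k\omega_iK_i^*y_i=0\Big\}.$$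 Assume that $(P)$ has an optimal solution $\hat x\in X$ and that at least one of the following conditions holds: 1. there is $x'\in\bigcap_{i=1}^kK_i^{-1}(\operatorname{dom} g_i)$ such that $g_i$ is continuous at $K_ix'$ for every $i=1,\dots,k$; 2. $0\in\operatorname{int}\big(\prod_{i=1}^k\operatorname{dom} g_i-\{(K_1x,\dots,K_kx):x\in X\}\big)$; 3. $0\in\operatorname{sqri}\big(\prod_{i=1}^k\operatorname{dom} g_i-\{(K_1x,\dots,K_kx):x\in X\}\big)$. Then: (i) There exists an optimal solution $(\hat y_1,\dots,\hat y_k)\in Y_1\times\dots\times Y_k$ of $(D)$, the optimal values of $(P)$ and $(D)$ coincide, and $$K_i\hat x\in\partial g_i^*(\hat y_i),\quad i=1,\dots,k,\qquad\text{and}\qquad \sum_{i=1}^k\omega_iK_i^*\hat y_i=0 .$$ (ii) Suppose that $X$ and $Y_1,\dots,Y_k$ are finite-dimensional. Let $\sigma,\tau>0$ satisfy $\sigma\tau\sum_{i=1}^k\|K_i\|^2<1$, let $(x^0,y_1^0,\dots,y_k^0)\in X\times Y_1\times\dots\times Y_k$ be arbitrary, put $\bar x^0:=x^0$, and for $n\ge0$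 set $$y_i^{n+1}:=\operatorname{prox}_{\sigma g_i^*}\big(y_i^n+\sigma K_i\bar x^n\big)\ (i=1,\dots,k),\qquad x^{n+1}:=x^n-\tau\sum_{i=1}^k\omega_iK_i^*y_i^{n+1},\qquad \bar x^{n+1}:=2x^{n+1}-x^n .$$ Then $(x^n)_{n\ge0}$ converges to an optimal solution of $(P)$ and $(y_1^n,\dots,y_k^n)_{n\ge0}$ converges to an optimal solution of $(D)$. -/

import Mathlib

open Filter Topology Set

noncomputable section

namespace PrimalDual

section Basic

variable {E : Type*}

/-- Effective domain of an extended-real-valued function. -/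
def dom (f : E → EReal) : Set E := {x | f x < ⊤}

/-- A function is proper if its domain is nonempty and it never takes the value `-∞`. -/
def IsProper (f : E → EReal) : Prop := (dom f).Nonempty ∧ ∀ x, ⊥ < f x

/-- Convexity of an extended-real-valued function: the epigraph is a convex set. -/
def IsConvex [AddCommGroup E] [Module ℝ E] (f : E → EReal) : Prop :=
  Convex ℝ {p : E × ℝ | f p.1 ≤ (p.2 : EReal)}

/-- Strong quasi-relative interior of a (convex) set: the points `x ∈ C` for which the cone
`⋃_{r > 0} r (C - x)` is a closed linear subspace. -/
def sqri [AddCommGroup E] [Module ℝ E] [TopologicalSpace E] (C : Set E) : Set E :=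
  {x | x ∈ C ∧ ∃ S : Submodule ℝ E, IsClosed (S : Set E) ∧
    {z : E | ∃ r : ℝ, 0 < r ∧ ∃ c ∈ C, z = r • (c - x)} = (S : Set E)}

variable [NormedAddCommGroup E] [InnerProductSpace ℝ E]

/-- Fenchel conjugate `f^*(u) = sup_x (⟨u, x⟩ - f x)`. -/
def conj (f : E → EReal) (u : E) : EReal := ⨆ x : E, ((inner ℝ u x : ℝ) : EReal) - f x

/-- Convex subdifferential, empty at points where `f` is not finite. -/
def subdiff (f : E → EReal) (x : E) : Set E :=
  {u | f x ≠ ⊤ ∧ f x ≠ ⊥ ∧ ∀ y : E, f x + ((inner ℝ u (y - x) : ℝ) : EReal) ≤ f y}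

/-- `p` is a minimizer of `y ↦ f y + (1 / (2γ)) ‖y - x‖²`. -/
def IsProxPoint (γ : ℝ) (f : E → EReal) (x p : E) : Prop :=
  IsMinOn (fun y : E => f y + ((1 / (2 * γ) * ‖y - x‖ ^ 2 : ℝ) : EReal)) univ p

/-- The proximal point of parameter `γ` of `f` at `x`. It is the minimizer described by
`IsProxPoint` (which exists and is unique for `γ > 0` and `f` proper, convex and lower
semicontinuous on a Hilbert space). -/
def prox (γ : ℝ) (f : E → EReal) (x : E) : E :=
  Classical.epsilon (IsProxPoint γ f x)

end Basic

section Problem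

variable {k : ℕ} {X : Type*} [NormedAddCommGroup X] [InnerProductSpace ℝ X] [CompleteSpace X]
  {Y : Fin k → Type*} [∀ i, NormedAddCommGroup (Y i)] [∀ i, InnerProductSpace ℝ (Y i)]
  [∀ i, CompleteSpace (Y i)]

/-- The primal objective `x ↦ ∑ ωᵢ gᵢ(Kᵢ x)`. -/
def primalObj (ω : Fin k → ℝ) (g : ∀ i, Y i → EReal) (K : ∀ i, X →L[ℝ] Y i) (x : X) : EReal :=
  ∑ i, (ω i : EReal) * g i (K i x)

/-- The dual objective `(y₁, …, y_k) ↦ ∑ -ωᵢ gᵢ^*(yᵢ)`. -/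
def dualObj (ω : Fin k → ℝ) (g : ∀ i, Y i → EReal) (y : ∀ i, Y i) : EReal :=
  ∑ i, -((ω i : EReal) * conj (g i) (y i))

/-- The dual feasible set `{y | ∑ ωᵢ Kᵢ^* yᵢ = 0}`. -/
def dualFeasible (ω : Fin k → ℝ) (K : ∀ i, X →L[ℝ] Y i) : Set (∀ i, Y i) :=
  {y | ∑ i, ω i • (ContinuousLinearMap.adjoint (K i)) (y i) = 0}

/-- `x` is an optimal solution of the primal problem. -/
def IsPrimalOptimal (ω : Fin k → ℝ) (g : ∀ i, Y i → EReal) (K : ∀ i, X →L[ℝ] Y i)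
    (x : X) : Prop :=
  IsMinOn (primalObj ω g K) univ x

/-- `y` is an optimal solution of the dual problem. -/
def IsDualOptimal (ω : Fin k → ℝ) (g : ∀ i, Y i → EReal) (K : ∀ i, X →L[ℝ] Y i)
    (y : ∀ i, Y i) : Prop :=
  y ∈ dualFeasible ω K ∧ IsMaxOn (dualObj ω g) (dualFeasible ω K) y

/-- Optimal value of the primal problem. -/
def primalValue (ω : Fin k → ℝ) (g : ∀ i, Y i → EReal) (K : ∀ i, X →L[ℝ] Y i) : EReal :=
  ⨅ x : X, primalObj ω g K x

/-- Optimal value of the dual problem. -/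
def dualValue (ω : Fin k → ℝ) (g : ∀ i, Y i → EReal) (K : ∀ i, X →L[ℝ] Y i) : EReal :=
  ⨆ y ∈ dualFeasible ω K, dualObj ω g y

/-- The set `∏ dom gᵢ - {(K₁ x, …, K_k x) : x ∈ X}` in the product space. -/
def diffSet (g : ∀ i, Y i → EReal) (K : ∀ i, X →L[ℝ] Y i) : Set (∀ i, Y i) :=
  {z | ∃ d ∈ univ.pi (fun i => dom (g i)), ∃ x : X, z = d - fun i => K i x}

/-- First qualification condition: the functions are continuous at a common domain point. -/
def QC1 (g : ∀ i, Y i → EReal) (K : ∀ i, X →L[ℝ] Y i) : Prop :=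
  ∃ x' : X, (∀ i, K i x' ∈ dom (g i)) ∧ ∀ i, ContinuousAt (g i) (K i x')

/-- Second qualification condition, through the interior. -/
def QC2 (g : ∀ i, Y i → EReal) (K : ∀ i, X →L[ℝ] Y i) : Prop :=
  (0 : ∀ i, Y i) ∈ interior (diffSet g K)

/-- Third qualification condition, through the strong quasi-relative interior. -/
def QC3 (g : ∀ i, Y i → EReal) (K : ∀ i, X →L[ℝ] Y i) : Prop :=
  (0 : ∀ i, Y i) ∈ sqri (diffSet g K)

/-- State `(xⁿ, x̄ⁿ, yⁿ)` of the primal-dual algorithm. -/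
structure State (X : Type*) {k : ℕ} (Y : Fin k → Type*) where
  x : X
  xbar : X
  y : ∀ i, Y i

/-- One iteration: first the dual variables, then `x`, then the extrapolated point `x̄`. -/
def step (ω : Fin k → ℝ) (g : ∀ i, Y i → EReal) (K : ∀ i, X →L[ℝ] Y i) (σ τ : ℝ)
    (s : State X Y) : State X Y :=
  let y' : ∀ i, Y i := fun i => prox σ (conj (g i)) (s.y i + σ • K i s.xbar)
  let x' : X := s.x - τ • ∑ i, ω i • (ContinuousLinearMap.adjoint (K i)) (y' i)
  { x := x', xbar := (2 : ℝ) • x' - s.x, y := y' }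

/-- The sequence generated by the algorithm from the starting point `(x⁰, y⁰)`, with `x̄⁰ = x⁰`. -/
def iter (ω : Fin k → ℝ) (g : ∀ i, Y i → EReal) (K : ∀ i, X →L[ℝ] Y i) (σ τ : ℝ)
    (x0 : X) (y0 : ∀ i, Y i) : ℕ → State X Y
  | 0 => { x := x0, xbar := x0, y := y0 }
  | n + 1 => step ω g K σ τ (iter ω g K σ τ x0 y0 n)

end Problem

end PrimalDual

end

/-
Everything is reduced to the optimality system `yᵢ ∈ ∂gᵢ(Kᵢ x)`, `∑ ωᵢ Kᵢ^* yᵢ = 0`: by weak duality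
its solutions solve both problems with equal values.

Duality. Perturb the arguments `Kᵢ x` of `gᵢ` by `zᵢ`. The qualification condition says that the
perturbations reachable from the closed convex epigraph of the perturbed problem absorb a closed
subspace, so by the Robinson–Ursescu theorem nearby perturbations are reached with bounded values.
The set above the graph of the value function then has an interior point on the axis `z = 0`, and
a supporting hyperplane at the optimal value is a dual solution.

Algorithm. With respect to the inner product on `X × ∏ Yᵢ` given by the form with blocks `τ⁻¹`,
`-K^*`, `-K`, `σ⁻¹`, which the step size condition makes coercive, the pairs `(xⁿ, yⁿ⁺¹)` are a
proximal point iteration for the monotone operator of the optimality system, hence Fejér monotone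
with vanishing steps. They stay in a translate of `(∑ range Kᵢ^*) × ∏ Yᵢ`, which is
finite-dimensional as soon as the `Yᵢ` are, so they have a cluster point; it solves the optimality
system, and by Fejér monotonicity it is the limit.
-/

noncomputable section

namespace PrimalDual

section ConvexSeries

open scoped Pointwise

open Metric

theorem mem_of_tendsto_sum_smul {V : Type*} [AddCommGroup V] [Module ℝ V] [TopologicalSpace V]
    [ContinuousSMul ℝ V] {B : Set V} (hB : Convex ℝ B) (hBcl : IsClosed B) {c : ℕ → ℝ}
    (hc : ∀ n, 0 ≤ c n) (hsum : HasSum c 1) {w : ℕ → V} (hw : ∀ n, w n ∈ B) {v : V}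
    (hv : Tendsto (fun n => ∑ j ∈ Finset.range n, c j • w j) atTop (𝓝 v)) : v ∈ B := by
  have hmass := hsum.tendsto_sum_nat
  have hmean : Tendsto (fun n => (Finset.range n).centerMass c w) atTop (𝓝 v) := by
    simpa only [Finset.centerMass, inv_one, one_smul] using (hmass.inv₀ one_ne_zero).smul hv
  refine hBcl.mem_of_tendsto hmean ?_
  filter_upwards [hmass.eventually_const_lt zero_lt_one] with n hn
  exact hB.centerMass_mem (fun j _ => hc j) hn fun j _ => hw j

theorem hasSum_half_pow_succ : HasSum (fun n : ℕ => (1 / 2 : ℝ) ^ (n + 1)) 1 := by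
  simpa [pow_succ'] using hasSum_geometric_two.mul_left (1 / 2 : ℝ)

variable {E Z : Type*} [NormedAddCommGroup E] [NormedSpace ℝ E]
  [NormedAddCommGroup Z] [NormedSpace ℝ Z]

theorem exists_dyadic_expansion {U : Set Z} {ρ : ℝ} (hU : ball 0 ρ ⊆ closure U) {z : Z}
    (hz : z ∈ ball 0 (ρ / 2)) :
    ∃ w : ℕ → Z, (∀ n, w n ∈ U) ∧
      Tendsto (fun n => ∑ j ∈ Finset.range n, (1 / 2 : ℝ) ^ (j + 1) • w j) atTop (𝓝 z) := by
  have norm_two_smul (x : Z) : ‖(2 : ℝ) • x‖ = 2 * ‖x‖ := by simp [norm_smul]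
  rw [mem_ball_zero_iff] at hz
  have hρ : 0 < ρ := by linarith [norm_nonneg z]
  have happrox (r : ball (0 : Z) ρ) : ∃ u ∈ U, (2 : ℝ) • (r.1 - u) ∈ ball (0 : Z) ρ := by
    obtain ⟨u, hu, hd⟩ := mem_closure_iff.1 (hU r.2) (ρ / 2) (half_pos hρ)
    refine ⟨u, hu, ?_⟩
    rw [mem_ball_zero_iff, norm_two_smul, ← dist_eq_norm]
    linarith
  choose w hwU hw using happrox
  let s : ℕ → ball (0 : Z) ρ := fun n =>
    n.rec ⟨(2 : ℝ) • z, by rw [mem_ball_zero_iff, norm_two_smul]; linarith⟩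
      fun _ r => ⟨(2 : ℝ) • (r.1 - w r), hw r⟩
  have hsum (n : ℕ) : ∑ j ∈ Finset.range n, (1 / 2 : ℝ) ^ (j + 1) • w (s j) =
      z - (1 / 2 : ℝ) ^ (n + 1) • (s n).1 := by
    induction n with
    | zero => simp [s, smul_smul]
    | succ n ih =>
      have hs : (s (n + 1)).1 = (2 : ℝ) • ((s n).1 - w (s n)) := rfl
      rw [Finset.sum_range_succ, ih, hs, pow_succ _ (n + 1)]
      module
  have hrest : Tendsto (fun n => (1 / 2 : ℝ) ^ (n + 1) • (s n).1) atTop (𝓝 0) := by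
    refine squeeze_zero_norm (a := fun n => (1 / 2 : ℝ) ^ (n + 1) * ρ) (fun n => ?_) ?_
    · rw [norm_smul, Real.norm_of_nonneg (by positivity)]
      gcongr
      exact (mem_ball_zero_iff.1 (s n).2).le
    · simpa using hasSum_half_pow_succ.summable.tendsto_atTop_zero.mul_const ρ
  refine ⟨fun n => w (s n), fun n => hwU _, ?_⟩
  simpa only [hsum, sub_zero] using tendsto_const_nhds.sub hrest

/-- The points related by `C` to some point of norm at most `R`. -/
def boundedRange (C : Set (E × Z)) (R : ℝ) : Set Z := {z | ∃ e, ‖e‖ ≤ R ∧ (e, z) ∈ C}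

theorem convex_boundedRange {C : Set (E × Z)} (hC : Convex ℝ C) (R : ℝ) :
    Convex ℝ (boundedRange C R) := by
  have himage : boundedRange C R = Prod.snd '' (C ∩ closedBall 0 R ×ˢ univ) := by
    ext z
    simp [boundedRange, and_comm]
  rw [himage]
  exact (hC.inter ((convex_closedBall 0 R).prod convex_univ)).linear_image (LinearMap.snd ℝ E Z)

theorem boundedRange_mem_nhds_zero_of_closure [CompleteSpace E] {C : Set (E × Z)}
    (hC : Convex ℝ C) (hCcl : IsClosed C) {R : ℝ} (h : closure (boundedRange C R) ∈ 𝓝 0) :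
    boundedRange C R ∈ 𝓝 0 := by
  obtain ⟨ρ, hρ, hball⟩ := Metric.mem_nhds_iff.1 h
  refine mem_of_superset (ball_mem_nhds 0 (half_pos hρ)) fun z hz => ?_
  obtain ⟨w, hw, hwz⟩ := exists_dyadic_expansion hball hz
  choose e he heC using hw
  have hbound (n : ℕ) : ‖(1 / 2 : ℝ) ^ (n + 1) • e n‖ ≤ (1 / 2 : ℝ) ^ (n + 1) * R := by
    rw [norm_smul, Real.norm_of_nonneg (by positivity)]
    gcongr
    exact he n
  have hgeom := hasSum_half_pow_succ.mul_right R
  rw [one_mul] at hgeom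
  have hlim := (Summable.of_norm_bounded hgeom.summable hbound).hasSum.tendsto_sum_nat
  refine ⟨_, tsum_of_norm_bounded hgeom hbound, mem_of_tendsto_sum_smul hC hCcl
    (fun n => by positivity) hasSum_half_pow_succ heC ((hlim.prodMk_nhds hwz).congr fun n => ?_)⟩
  ext <;> simp [Prod.fst_sum, Prod.snd_sum]

/- By Baire some multiple of `B` has an interior point, and then so has `B`; the segment joining it
to a point of `B` on the opposite ray passes through `0` in the interior. -/
theorem mem_nhds_zero_of_absorbing [CompleteSpace Z] {B : Set Z} (hB : Convex ℝ B)
    (hBcl : IsClosed B) (habs : ∀ z, ∃ r : ℝ, 0 < r ∧ ∃ b ∈ B, z = r • b) : B ∈ 𝓝 0 := by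
  have hzero : (0 : Z) ∈ B := by
    obtain ⟨r, hr, b, hb, h⟩ := habs 0
    rwa [(smul_eq_zero_iff_right hr.ne').1 h.symm] at hb
  have hcover : ⋃ n : ℕ, ((n : ℝ) + 1) • B = univ := by
    refine eq_univ_of_forall fun z => ?_
    obtain ⟨r, hr, b, hb, rfl⟩ := habs z
    obtain ⟨n, hn⟩ := exists_nat_ge r
    have hn' : (0 : ℝ) < n + 1 := by positivity
    refine mem_iUnion.2 ⟨n, (r / (n + 1)) • b, ?_, ?_⟩
    · exact hB.smul_mem_of_zero_mem hzero hb
        ⟨by positivity, (div_le_one hn').2 (by linarith)⟩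
    · simp only [smul_smul, mul_div_cancel₀ _ hn'.ne']
  obtain ⟨n, hn⟩ := nonempty_interior_of_iUnion_of_closed
    (fun n : ℕ => hBcl.smul₀ ((n : ℝ) + 1)) hcover
  rw [interior_smul₀ (by positivity)] at hn
  obtain ⟨v, hv⟩ := smul_set_nonempty.1 hn
  obtain ⟨r, hr, b, hb, hvb⟩ := habs (-v)
  rw [← mem_interior_iff_mem_nhds]
  convert hB.combo_interior_self_mem_interior hv hb (a := 1 / (1 + r)) (b := r / (1 + r))
    (by positivity) (by positivity) (by field_simp) using 1
  rw [div_eq_inv_mul r, mul_smul, ← hvb]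
  simp

theorem boundedRange_absorbing {C : Set (E × Z)} (hC : Convex ℝ C) {e₀ : E} (h₀ : (e₀, 0) ∈ C)
    {z : Z} (hz : ∃ r : ℝ, 0 < r ∧ ∃ c ∈ Prod.snd '' C, z = r • c) :
    ∃ r : ℝ, 0 < r ∧ ∃ c ∈ boundedRange C (‖e₀‖ + 1), z = r • c := by
  obtain ⟨r, hr, _, ⟨⟨e, c⟩, hec, rfl⟩, rfl⟩ := hz
  set t := (1 + ‖e - e₀‖)⁻¹
  have ht : 0 < t := by positivity
  have ht1 : t ≤ 1 := inv_le_one_of_one_le₀ (by linarith [norm_nonneg (e - e₀)])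
  refine ⟨r / t, by positivity, t • c, ⟨e₀ + t • (e - e₀), ?_, ?_⟩, ?_⟩
  · have hte : ‖t • (e - e₀)‖ ≤ 1 := by
      rw [norm_smul, Real.norm_of_nonneg ht.le, inv_mul_le_one₀ (by positivity)]
      linarith
    linarith [norm_add_le e₀ (t • (e - e₀))]
  · convert hC.add_smul_sub_mem h₀ hec ⟨ht.le, ht1⟩ using 1
    ext <;> simp
  · rw [smul_smul, div_mul_cancel₀ _ ht.ne']

/- The Robinson–Ursescu open mapping theorem. -/
theorem exists_boundedRange_mem_nhds_zero [CompleteSpace E] [CompleteSpace Z] {C : Set (E × Z)}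
    (hC : Convex ℝ C) (hCcl : IsClosed C)
    (habs : ∀ z : Z, ∃ r : ℝ, 0 < r ∧ ∃ c ∈ Prod.snd '' C, z = r • c) :
    ∃ R, boundedRange C R ∈ 𝓝 0 := by
  obtain ⟨r, hr, _, ⟨⟨e₀, c⟩, hec, rfl⟩, h⟩ := habs 0
  obtain rfl : c = 0 := (smul_eq_zero_iff_right hr.ne').1 h.symm
  refine ⟨‖e₀‖ + 1, boundedRange_mem_nhds_zero_of_closure hC hCcl
    (mem_nhds_zero_of_absorbing (convex_boundedRange hC _).closure isClosed_closure fun z => ?_)⟩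
  obtain ⟨s, hs, b, hb, rfl⟩ := boundedRange_absorbing hC hec (habs z)
  exact ⟨s, hs, b, subset_closure hb, rfl⟩

end ConvexSeries

section Multiplier

variable {E Z : Type*} [NormedAddCommGroup E] [NormedSpace ℝ E]
  [NormedAddCommGroup Z] [NormedSpace ℝ Z]

theorem exists_multiplier_of_mem_interior {T : Set (Z × ℝ)} (hT : Convex ℝ T) {p M : ℝ}
    (hp : ∀ t, ((0 : Z), t) ∈ T → p ≤ t) (hM : ((0 : Z), M) ∈ interior T) :
    ∃ l : Z →L[ℝ] ℝ, ∀ z t, (z, t) ∈ T → p + l z ≤ t := by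
  have hnot : ((0 : Z), p) ∉ interior T := by
    intro h
    have hvertical : Tendsto (fun t : ℝ => ((0 : Z), t)) (𝓝[<] p) (𝓝 ((0 : Z), p)) :=
      ((Continuous.prodMk_right (0 : Z)).tendsto p).mono_left nhdsWithin_le_nhds
    obtain ⟨t, ht, htp⟩ :=
      ((hvertical.eventually (mem_interior_iff_mem_nhds.1 h)).and self_mem_nhdsWithin).exists
    exact (hp t ht).not_gt htp
  obtain ⟨f, hf⟩ := geometric_hahn_banach_open_point hT.interior isOpen_interior hnot
  have hle (q : Z × ℝ) (hq : q ∈ T) : f q ≤ f (0, p) := by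
    refine closure_minimal (fun a ha => (hf a ha).le)
      (isClosed_le f.continuous continuous_const) (?_ : q ∈ closure (interior T))
    rw [hT.closure_interior_eq_closure_of_nonempty_interior ⟨_, hM⟩]
    exact subset_closure hq
  have hdecomp (z : Z) (t : ℝ) : f (z, t) = f (z, 0) + t * f (0, 1) := by
    rw [← smul_eq_mul, ← map_smul, ← map_add]
    simp
  have hzero : f ((0 : Z), (0 : ℝ)) = 0 := f.map_zero
  have hneg : f (0, 1) < 0 := by
    have hlt := hf _ hM
    rw [hdecomp, hdecomp 0 p] at hlt
    nlinarith [hp M (interior_subset hM)]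
  refine ⟨(-f (0, 1))⁻¹ • f.comp (ContinuousLinearMap.inl ℝ Z ℝ), fun z t hzt => ?_⟩
  have h := hle _ hzt
  rw [hdecomp, hdecomp 0 p, hzero] at h
  have hl : (-f (0, 1))⁻¹ * f (z, 0) ≤ t - p := by
    rw [inv_mul_le_iff₀ (neg_pos.2 hneg)]
    linarith
  simpa [add_comm] using add_le_of_le_sub_left hl

theorem exists_multiplier_of_absorbing [CompleteSpace E] [CompleteSpace Z] {C : Set (E × Z)}
    (hC : Convex ℝ C) (hCcl : IsClosed C)
    (habs : ∀ z : Z, ∃ r : ℝ, 0 < r ∧ ∃ c ∈ Prod.snd '' C, z = r • c) (φ : E →L[ℝ] ℝ) {p : ℝ}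
    (hp : ∀ e, (e, 0) ∈ C → p ≤ φ e) :
    ∃ l : Z →L[ℝ] ℝ, ∀ e z, (e, z) ∈ C → p + l z ≤ φ e := by
  obtain ⟨R, hR⟩ := exists_boundedRange_mem_nhds_zero hC hCcl habs
  let T : Set (Z × ℝ) := {q | ∃ e, (e, q.1) ∈ C ∧ φ e ≤ q.2}
  have hT : Convex ℝ T := by
    rintro q ⟨e, he, heq⟩ q' ⟨e', he', heq'⟩ a b ha hb hab
    refine ⟨a • e + b • e', hC he he' ha hb hab, ?_⟩
    simp only [map_add, map_smul, Prod.snd_add, Prod.smul_snd]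
    gcongr
  have hinterior : ((0 : Z), ‖φ‖ * R + 1) ∈ interior T := by
    rw [mem_interior_iff_mem_nhds, nhds_prod_eq]
    filter_upwards [prod_mem_prod hR (Ioi_mem_nhds (lt_add_one (‖φ‖ * R)))]
    rintro ⟨z, t⟩ ⟨⟨e, he, hez⟩, ht⟩
    refine ⟨e, hez, ?_⟩
    calc φ e ≤ ‖φ‖ * ‖e‖ := (le_abs_self _).trans (φ.le_opNorm e)
      _ ≤ ‖φ‖ * R := by gcongr
      _ ≤ t := le_of_lt ht
  obtain ⟨l, hl⟩ := exists_multiplier_of_mem_interior hT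
    (fun t ⟨e, he, het⟩ => (hp e he).trans het) hinterior
  exact ⟨l, fun e z hez => hl z _ ⟨e, hez, le_rfl⟩⟩

theorem exists_multiplier_of_zero_mem_sqri [CompleteSpace E] [CompleteSpace Z] {C : Set (E × Z)}
    (hC : Convex ℝ C) (hCcl : IsClosed C) (hsqri : 0 ∈ sqri (Prod.snd '' C)) (φ : E →L[ℝ] ℝ)
    {p : ℝ} (hp : ∀ e, (e, 0) ∈ C → p ≤ φ e) :
    ∃ l : Z →L[ℝ] ℝ, ∀ e z, (e, z) ∈ C → p + l z ≤ φ e := by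
  obtain ⟨-, S, hScl, hS⟩ := hsqri
  have : CompleteSpace S := hScl.completeSpace_coe
  have hrange {e : E} {z : Z} (hez : (e, z) ∈ C) : z ∈ S := by
    rw [← SetLike.mem_coe, ← hS]
    exact ⟨1, one_pos, z, ⟨_, hez, rfl⟩, by simp⟩
  let incl : E × S →L[ℝ] E × Z := (ContinuousLinearMap.id ℝ E).prodMap S.subtypeL
  have habs (z : S) : ∃ r : ℝ, 0 < r ∧ ∃ c ∈ Prod.snd '' (incl ⁻¹' C), z = r • c := by
    obtain ⟨r, hr, _, ⟨⟨e, c⟩, hec, rfl⟩, hz⟩ :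
        (z : Z) ∈ {z | ∃ r : ℝ, 0 < r ∧ ∃ c ∈ Prod.snd '' C, z = r • (c - 0)} := hS ▸ z.2
    refine ⟨r, hr, ⟨c, hrange hec⟩, ⟨(e, ⟨c, hrange hec⟩), hec, rfl⟩, ?_⟩
    ext
    simpa using hz
  obtain ⟨l, hl⟩ := exists_multiplier_of_absorbing (hC.linear_preimage incl.toLinearMap)
    (hCcl.preimage incl.continuous) habs φ hp
  obtain ⟨L, hL, -⟩ := exists_extension_norm_eq S l
  refine ⟨L, fun e z hez => ?_⟩
  have hLz : L z = l ⟨z, hrange hez⟩ := hL ⟨z, hrange hez⟩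
  rw [hLz]
  exact hl e ⟨z, hrange hez⟩ hez

end Multiplier

section ExtendedReals

variable {ι : Type*} {s : Finset ι}

theorem coe_finset_sum (s : Finset ι) (f : ι → ℝ) :
    ((∑ i ∈ s, f i : ℝ) : EReal) = ∑ i ∈ s, (f i : EReal) := by
  classical
  induction s using Finset.induction_on with
  | empty => simp
  | insert a s ha ih => rw [Finset.sum_insert ha, Finset.sum_insert ha, EReal.coe_add, ih]

theorem sum_ne_bot {f : ι → EReal} (h : ∀ i ∈ s, f i ≠ ⊥) : ∑ i ∈ s, f i ≠ ⊥ := by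
  classical
  induction s using Finset.induction_on with
  | empty => simp
  | insert a s ha ih =>
    rw [Finset.sum_insert ha, Ne, EReal.add_eq_bot_iff, not_or]
    exact ⟨h a (Finset.mem_insert_self a s), ih fun i hi => h i (Finset.mem_insert_of_mem hi)⟩

theorem sum_eq_top {f : ι → EReal} (h : ∀ i ∈ s, f i ≠ ⊥) {i : ι} (hi : i ∈ s)
    (hf : f i = ⊤) : ∑ i ∈ s, f i = ⊤ := by
  classical
  rw [← Finset.add_sum_erase s f hi, hf, EReal.top_add_of_ne_bot]
  exact sum_ne_bot fun j hj => h j (Finset.mem_of_mem_erase hj)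

end ExtendedReals

section Conjugate

variable {E : Type*}

theorem IsProper.exists_eq_coe {f : E → EReal} (hf : IsProper f) {x : E} (hx : x ∈ dom f) :
    ∃ r : ℝ, f x = r :=
  ⟨(f x).toReal, (EReal.coe_toReal hx.ne (hf.2 x).ne').symm⟩

theorem isClosed_realEpigraph [TopologicalSpace E] {f : E → EReal} (hf : LowerSemicontinuous f) :
    IsClosed {p : E × ℝ | f p.1 ≤ (p.2 : EReal)} :=
  hf.isClosed_epigraph.preimage
    (continuous_fst.prodMk (continuous_coe_real_ereal.comp continuous_snd))

variable [NormedAddCommGroup E] [InnerProductSpace ℝ E] {f : E → EReal} {u v x y : E}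

theorem inner_sub_le_conj {t : ℝ} (h : f x ≤ t) (u : E) :
    ((inner ℝ u x - t : ℝ) : EReal) ≤ conj f u := by
  refine le_trans ?_ (le_iSup (fun x : E => ((inner ℝ u x : ℝ) : EReal) - f x) x)
  rw [EReal.coe_sub]
  exact EReal.sub_le_sub le_rfl h

theorem conj_le_iff {r : ℝ} :
    conj f u ≤ r ↔ ∀ (x : E) (t : ℝ), f x ≤ t → inner ℝ u x - t ≤ r := by
  refine ⟨fun h x t hxt => ?_, fun h => iSup_le fun x => ?_⟩
  · exact_mod_cast (inner_sub_le_conj hxt u).trans h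
  · induction hx : f x with
    | bot => linarith [h x (inner ℝ u x - r - 1) (by simp [hx])]
    | top => simp
    | coe t => exact_mod_cast h x t hx.le

theorem conj_conj_le (f : E → EReal) (x : E) : conj (conj f) x ≤ f x := by
  refine EReal.le_of_forall_lt_iff_le.1 fun t ht => conj_le_iff.2 fun u s hus => ?_
  rw [real_inner_comm]
  linarith [conj_le_iff.1 hus x t ht.le]

theorem inner_sub_le_of_conj_le {s : ℝ} (h : conj f u ≤ s) (x : E) :
    ((inner ℝ u x - s : ℝ) : EReal) ≤ f x := by
  rw [← real_inner_comm]
  exact (inner_sub_le_conj h x).trans (conj_conj_le f x)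

theorem isProper_conj (hf : IsProper f) (hdom : (dom (conj f)).Nonempty) : IsProper (conj f) := by
  obtain ⟨x, hx⟩ := hf.1
  obtain ⟨r, hr⟩ := hf.exists_eq_coe hx
  exact ⟨hdom, fun u => (EReal.bot_lt_coe _).trans_le (inner_sub_le_conj hr.le u)⟩

theorem isConvex_conj (f : E → EReal) : IsConvex (conj f) := by
  rintro ⟨u, s⟩ hu ⟨v, t⟩ hv a b ha hb hab
  refine conj_le_iff.2 fun x r hxr => ?_
  have hu' := mul_le_mul_of_nonneg_left (conj_le_iff.1 hu x r hxr) ha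
  have hv' := mul_le_mul_of_nonneg_left (conj_le_iff.1 hv x r hxr) hb
  have hr : r = a * r + b * r := by rw [← add_mul, hab, one_mul]
  simp only [Prod.fst_add, Prod.smul_fst, Prod.snd_add, Prod.smul_snd, inner_add_left,
    real_inner_smul_left, smul_eq_mul] at hu' hv' ⊢
  linarith

theorem lowerSemicontinuous_conj (f : E → EReal) : LowerSemicontinuous (conj f) := by
  refine lowerSemicontinuous_iSup fun x => Continuous.lowerSemicontinuous ?_
  induction f x with
  | bot => simpa only [EReal.coe_sub_bot] using continuous_const
  | top => simpa only [EReal.sub_top] using continuous_const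
  | coe r =>
    simp only [← EReal.coe_sub]
    exact continuous_coe_real_ereal.comp (by fun_prop)

/- The separating hyperplane is vertical when `c = 0`. -/
theorem exists_separating_epigraph [CompleteSpace E] (hdom : (dom f).Nonempty)
    (hconv : IsConvex f) (hlsc : LowerSemicontinuous f) {r : ℝ} (hr : r < f x) :
    ∃ (v : E) (c β : ℝ), 0 ≤ c ∧ inner ℝ v x + c * r < β ∧
      ∀ (y : E) (t : ℝ), f y ≤ t → β < inner ℝ v y + c * t := by
  obtain ⟨F, β, hx, hepi⟩ := geometric_hahn_banach_point_closed (x := (x, r))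
    hconv (isClosed_realEpigraph hlsc) (not_le.2 hr)
  let v := (InnerProductSpace.toDual ℝ E).symm (F.comp (ContinuousLinearMap.inl ℝ E ℝ))
  have hF (y : E) (t : ℝ) : F (y, t) = inner ℝ v y + F (0, 1) * t := by
    have hsplit : ((y, t) : E × ℝ) = (y, 0) + t • (0, 1) := by simp
    rw [hsplit, map_add, map_smul, smul_eq_mul, mul_comm t, InnerProductSpace.toDual_symm_apply]
    rfl
  have hepi' (y : E) (t : ℝ) (hyt : f y ≤ t) : β < inner ℝ v y + F (0, 1) * t := by
    rw [← hF]
    exact hepi (y, t) hyt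
  refine ⟨v, F (0, 1), β, ?_, hF x r ▸ hx, hepi'⟩
  by_contra! hneg
  obtain ⟨y, hy⟩ := hdom
  obtain ⟨t, hyt, -⟩ := EReal.lt_iff_exists_real_btwn.1 hy
  obtain ⟨T, hT, htT⟩ : ∃ T, inner ℝ v y + F (0, 1) * T ≤ β ∧ t ≤ T := by
    refine (Tendsto.eventually_le_atBot ?_ β |>.and (eventually_ge_atTop t)).exists
    exact tendsto_atBot_add_const_left _ _ (tendsto_id.const_mul_atTop_of_neg hneg)
  exact (hepi' y T (hyt.le.trans (EReal.coe_le_coe_iff.2 htT))).not_ge hT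

/- The separating hyperplane may be vertical, hence a large multiple `n` of it is added to a
nonvertical affine minorant of `f`, which exists because `conj f` has a point in its domain. -/
theorem le_conj_conj [CompleteSpace E] (hdom : (dom f).Nonempty) (hconv : IsConvex f)
    (hlsc : LowerSemicontinuous f) (hdom' : (dom (conj f)).Nonempty) (x : E) :
    f x ≤ conj (conj f) x := by
  refine EReal.ge_of_forall_gt_iff_ge.1 fun r hr => ?_
  obtain ⟨v, c, β, hc, hx, hepi⟩ := exists_separating_epigraph hdom hconv hlsc hr
  obtain ⟨u, hu⟩ := hdom'
  obtain ⟨s, hus, -⟩ := EReal.lt_iff_exists_real_btwn.1 hu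
  obtain ⟨n, hn⟩ := exists_nat_ge ((r + s - inner ℝ u x) / (β - (inner ℝ v x + c * r)))
  rw [div_le_iff₀ (sub_pos.2 hx)] at hn
  have hpos : 0 < 1 + n * c := by positivity
  have hconj : conj f ((1 + n * c)⁻¹ • (u - (n : ℝ) • v)) ≤
      ((1 + n * c)⁻¹ * (s - n * β) : ℝ) := by
    refine conj_le_iff.2 fun y t hyt => ?_
    have hy := mul_le_mul_of_nonneg_left (hepi y t hyt).le n.cast_nonneg
    have hy' := conj_le_iff.1 hus.le y t hyt
    rw [real_inner_smul_left, inner_sub_left, real_inner_smul_left, sub_le_iff_le_add,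
      inv_mul_le_iff₀ hpos, mul_add, mul_inv_cancel_left₀ hpos.ne']
    linarith
  refine le_trans (EReal.coe_le_coe_iff.2 ?_) (inner_sub_le_conj hconj x)
  rw [real_inner_comm, real_inner_smul_left, inner_sub_left, real_inner_smul_left, ← mul_sub,
    le_inv_mul_iff₀ hpos]
  linarith

end Conjugate

section Subdifferential

variable {E : Type*} [NormedAddCommGroup E] [InnerProductSpace ℝ E] {f : E → EReal} {u v x y : E}

theorem mem_subdiff_iff_forall_le (hf : IsProper f) :
    u ∈ subdiff f x ↔
      ∀ (y : E) (t : ℝ), f y ≤ t → f x ≤ ((t - inner ℝ u (y - x) : ℝ) : EReal) := by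
  constructor
  · rintro ⟨htop, hbot, h⟩ y t hyt
    lift f x to ℝ using ⟨htop, hbot⟩ with r
    have hr : r + inner ℝ u (y - x) ≤ t := by exact_mod_cast (h y).trans hyt
    exact_mod_cast le_sub_right_of_add_le hr
  · intro h
    obtain ⟨y, hy⟩ := hf.1
    obtain ⟨s, hs⟩ := hf.exists_eq_coe hy
    have hx := (h y s hs.le).trans_lt (EReal.coe_lt_top _)
    refine ⟨hx.ne, (hf.2 x).ne', fun y => EReal.le_of_forall_lt_iff_le.1 fun t ht => ?_⟩
    obtain ⟨r, hr⟩ := hf.exists_eq_coe hx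
    have hle := h y t ht.le
    rw [hr] at hle ⊢
    exact_mod_cast add_le_of_le_sub_right (EReal.coe_le_coe_iff.1 hle)

theorem mem_subdiff_iff_exists_add_le :
    u ∈ subdiff f x ↔
      ∃ r s : ℝ, f x ≤ r ∧ conj f u ≤ s ∧ r + s ≤ inner ℝ u x := by
  constructor
  · rintro ⟨htop, hbot, h⟩
    lift f x to ℝ using ⟨htop, hbot⟩ with r
    refine ⟨r, inner ℝ u x - r, le_rfl, conj_le_iff.2 fun y t hyt => ?_, by linarith⟩
    have hr : r + inner ℝ u (y - x) ≤ t := by exact_mod_cast (h y).trans hyt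
    rw [inner_sub_right] at hr
    linarith
  · rintro ⟨r, s, hr, hs, hrs⟩
    have hbot : f x ≠ ⊥ := ((EReal.bot_lt_coe _).trans_le (inner_sub_le_of_conj_le hs x)).ne'
    refine ⟨(hr.trans_lt (EReal.coe_lt_top r)).ne, hbot, fun y => ?_⟩
    refine EReal.le_of_forall_lt_iff_le.1 fun t ht => ?_
    have hy := conj_le_iff.1 hs y t ht.le
    refine (add_le_add_left hr _).trans ?_
    rw [← EReal.coe_add, EReal.coe_le_coe_iff, inner_sub_right]
    linarith

theorem mem_subdiff_conj_iff [CompleteSpace E] (hdom : (dom f).Nonempty) (hconv : IsConvex f)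
    (hlsc : LowerSemicontinuous f) : x ∈ subdiff (conj f) u ↔ u ∈ subdiff f x := by
  simp only [mem_subdiff_iff_exists_add_le, real_inner_comm u x]
  constructor
  · rintro ⟨s, r, hs, hr, hrs⟩
    have hdom' : (dom (conj f)).Nonempty := ⟨u, hs.trans_lt (EReal.coe_lt_top s)⟩
    exact ⟨r, s, (le_conj_conj hdom hconv hlsc hdom' x).trans hr, hs, add_comm s r ▸ hrs⟩
  · rintro ⟨r, s, hr, hs, hrs⟩
    exact ⟨s, r, hs, (conj_conj_le f x).trans hr, add_comm r s ▸ hrs⟩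

theorem inner_sub_nonneg_of_mem_subdiff (hu : u ∈ subdiff f x) (hv : v ∈ subdiff f y) :
    0 ≤ inner ℝ (u - v) (x - y) := by
  obtain ⟨r, s, hr, hs, hrs⟩ := mem_subdiff_iff_exists_add_le.1 hu
  obtain ⟨r', s', hr', hs', hrs'⟩ := mem_subdiff_iff_exists_add_le.1 hv
  have hcross := conj_le_iff.1 hs y r' hr'
  have hcross' := conj_le_iff.1 hs' x r hr
  simp only [inner_sub_left, inner_sub_right]
  linarith

theorem isClosed_graph_subdiff (hf : IsProper f) (hlsc : LowerSemicontinuous f) :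
    IsClosed {q : E × E | q.2 ∈ subdiff f q.1} := by
  simp only [mem_subdiff_iff_forall_le hf, ofPred_forall]
  refine isClosed_iInter fun y => isClosed_iInter fun t => isClosed_iInter fun _ => ?_
  exact (isClosed_realEpigraph hlsc).preimage (f := fun q : E × E =>
    (q.1, t - inner ℝ q.2 (y - q.1))) (by fun_prop)

end Subdifferential

section Prox

variable {E : Type*} [NormedAddCommGroup E] [InnerProductSpace ℝ E] {f : E → EReal} {γ : ℝ}

/- Completing the square: an affine minorant `⟨u, y⟩ - s` of `f` confines the sublevel sets of the
proximal objective to balls centred at `v - γ u`. -/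
theorem norm_sub_sq_le_of_proximal_le {u : E} {s : ℝ} (hu : conj f u ≤ s) (hγ : 0 < γ) {v y : E}
    {c : ℝ} (hy : f y + ((1 / (2 * γ) * ‖y - v‖ ^ 2 : ℝ) : EReal) ≤ c) :
    ‖y - (v - γ • u)‖ ^ 2 ≤ 2 * γ * (c + s - inner ℝ u v) + γ ^ 2 * ‖u‖ ^ 2 := by
  have hc : inner ℝ u y - s + 1 / (2 * γ) * ‖y - v‖ ^ 2 ≤ c := by
    have := (add_le_add_left (inner_sub_le_of_conj_le hu y) _).trans hy
    exact_mod_cast this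
  have hscaled := mul_le_mul_of_nonneg_left hc (by positivity : 0 ≤ 2 * γ)
  rw [mul_add, ← mul_assoc (2 * γ) (1 / _), mul_one_div_cancel (by positivity), one_mul]
    at hscaled
  rw [sub_sub_eq_add_sub, add_sub_right_comm, norm_add_sq_real, real_inner_smul_right,
    norm_smul, Real.norm_of_nonneg hγ.le, inner_sub_left, real_inner_comm u y,
    real_inner_comm u v]
  linarith

theorem exists_isProxPoint [ProperSpace E] (hf : IsProper f) (hlsc : LowerSemicontinuous f)
    (hdom : (dom (conj f)).Nonempty) (hγ : 0 < γ) (v : E) : ∃ p, IsProxPoint γ f v p := by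
  obtain ⟨u, hu⟩ := hdom
  obtain ⟨s, hs, -⟩ := EReal.lt_iff_exists_real_btwn.1 hu
  obtain ⟨x, hx⟩ := hf.1
  obtain ⟨r, hr⟩ := hf.exists_eq_coe hx
  let h : E → EReal := fun y => f y + ((1 / (2 * γ) * ‖y - v‖ ^ 2 : ℝ) : EReal)
  have hhlsc : LowerSemicontinuous h := by
    have hquad : Continuous fun y : E => ((1 / (2 * γ) * ‖y - v‖ ^ 2 : ℝ) : EReal) :=
      continuous_coe_real_ereal.comp (by fun_prop)
    exact hlsc.add' hquad.lowerSemicontinuous fun y =>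
      EReal.continuousAt_add (Or.inr (EReal.coe_ne_bot _)) (Or.inr (EReal.coe_ne_top _))
  let c : ℝ := r + 1 / (2 * γ) * ‖x - v‖ ^ 2
  have hxc : h x ≤ c := by simp only [h, c, hr, EReal.coe_add, le_refl]
  have hcompact : IsCompact {y | h y ≤ c} := by
    refine (isCompact_closedBall (v - γ • u) √(2 * γ * (c + s - inner ℝ u v) +
      γ ^ 2 * ‖u‖ ^ 2)).of_isClosed_subset (hhlsc.isClosed_preimage c) fun y hy => ?_
    rw [mem_closedBall_iff_norm]
    exact Real.le_sqrt_of_sq_le (norm_sub_sq_le_of_proximal_le hs.le hγ hy)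
  obtain ⟨p, hpc, hp⟩ := (hhlsc.lowerSemicontinuousOn _).exists_isMinOn ⟨x, hxc⟩ hcompact
  exact ⟨p, fun y _ => (le_total (h y) c).elim (fun hy => hp hy) fun hy => le_trans hpc hy⟩

theorem IsProxPoint.exists_eq_coe {E : Type*} [NormedAddCommGroup E] {f : E → EReal}
    (hf : IsProper f) {v p : E} (hp : IsProxPoint γ f v p) : ∃ r : ℝ, f p = r := by
  obtain ⟨x, hx⟩ := hf.1
  obtain ⟨r, hr⟩ := hf.exists_eq_coe hx
  refine hf.exists_eq_coe (show f p < ⊤ from lt_top_iff_ne_top.2 fun htop => ?_)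
  have hle := hp (mem_univ x)
  simp only [htop, EReal.top_add_coe, hr, ← EReal.coe_add, mem_ofPred_eq, top_le_iff,
    EReal.coe_ne_top] at hle

theorem IsProxPoint.mem_subdiff (hf : IsProper f) (hconv : IsConvex f) {v p : E}
    (hp : IsProxPoint γ f v p) : γ⁻¹ • (v - p) ∈ subdiff f p := by
  obtain ⟨r, hr⟩ := hp.exists_eq_coe hf
  refine (mem_subdiff_iff_forall_le hf).2 fun y t hyt => ?_
  rw [hr, EReal.coe_le_coe_iff]
  have hstep (θ : ℝ) (hθ : θ ∈ Ioo (0 : ℝ) 1) :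
      r ≤ t - inner ℝ (γ⁻¹ • (v - p)) (y - p) + θ * (1 / (2 * γ) * ‖y - p‖ ^ 2) := by
    have hmem := hconv.add_smul_sub_mem (x := (p, r)) (y := (y, t)) hr.le hyt
      ⟨hθ.1.le, hθ.2.le⟩
    have hmin : f p + ((1 / (2 * γ) * ‖p - v‖ ^ 2 : ℝ) : EReal) ≤
        ((r + θ * (t - r) + 1 / (2 * γ) * ‖p + θ • (y - p) - v‖ ^ 2 : ℝ) : EReal) := by
      rw [EReal.coe_add]
      exact (hp (mem_univ _)).trans (add_le_add_left hmem _)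
    rw [hr, ← EReal.coe_add, EReal.coe_le_coe_iff, add_sub_right_comm, norm_add_sq_real,
      real_inner_smul_right, norm_smul, Real.norm_of_nonneg hθ.1.le, ← neg_sub v p,
      inner_neg_left, norm_neg] at hmin
    rw [real_inner_smul_left]
    refine le_of_mul_le_mul_left ?_ hθ.1
    linear_combination hmin
  have hlim : Tendsto (fun θ : ℝ => t - inner ℝ (γ⁻¹ • (v - p)) (y - p) +
      θ * (1 / (2 * γ) * ‖y - p‖ ^ 2)) (𝓝[>] 0) (𝓝 (t - inner ℝ (γ⁻¹ • (v - p)) (y - p))) :=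
    tendsto_nhdsWithin_of_tendsto_nhds (Continuous.tendsto' (by fun_prop) _ _ (by simp))
  exact ge_of_tendsto hlim (by
    filter_upwards [Ioo_mem_nhdsGT one_pos] with θ hθ using hstep θ hθ)

theorem prox_mem_subdiff [ProperSpace E] (hf : IsProper f) (hconv : IsConvex f)
    (hlsc : LowerSemicontinuous f) (hdom : (dom (conj f)).Nonempty) (hγ : 0 < γ) (v : E) :
    γ⁻¹ • (v - prox γ f v) ∈ subdiff f (prox γ f v) :=
  IsProxPoint.mem_subdiff hf hconv
    (Classical.epsilon_spec (exists_isProxPoint hf hlsc hdom hγ v))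

end Prox

section Duality

variable {k : ℕ} {X : Type*} [NormedAddCommGroup X] [InnerProductSpace ℝ X]
  {Y : Fin k → Type*} [∀ i, NormedAddCommGroup (Y i)] [∀ i, InnerProductSpace ℝ (Y i)]
  {ω : Fin k → ℝ} {g : ∀ i, Y i → EReal} {K : ∀ i, X →L[ℝ] Y i} {x : X} {y : ∀ i, Y i}

theorem primalObj_le (hω : ∀ i, 0 ≤ ω i) {r : Fin k → ℝ} (h : ∀ i, g i (K i x) ≤ r i) :
    primalObj ω g K x ≤ ((∑ i, ω i * r i : ℝ) : EReal) := by
  simp only [primalObj, coe_finset_sum, EReal.coe_mul]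
  exact Finset.sum_le_sum fun i _ =>
    mul_le_mul_of_nonneg_left (h i) (EReal.coe_nonneg.2 (hω i))

theorem primalObj_eq {r : Fin k → ℝ} (h : ∀ i, g i (K i x) = r i) :
    primalObj ω g K x = ((∑ i, ω i * r i : ℝ) : EReal) := by
  simp only [primalObj, coe_finset_sum, EReal.coe_mul, h]

theorem le_dualObj (hω : ∀ i, 0 ≤ ω i) {s : Fin k → ℝ} (h : ∀ i, conj (g i) (y i) ≤ s i) :
    ((∑ i, -(ω i * s i) : ℝ) : EReal) ≤ dualObj ω g y := by
  simp only [dualObj, coe_finset_sum, EReal.coe_neg, EReal.coe_mul]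
  exact Finset.sum_le_sum fun i _ => EReal.neg_le_neg_iff.2 <|
    mul_le_mul_of_nonneg_left (h i) (EReal.coe_nonneg.2 (hω i))

theorem primalObj_eq_top (hω : ∀ i, 0 < ω i) (hg : ∀ i, IsProper (g i)) {i : Fin k}
    (h : g i (K i x) = ⊤) : primalObj ω g K x = ⊤ := by
  refine sum_eq_top (fun j _ => ?_) (Finset.mem_univ i) ?_
  · rw [EReal.mul_ne_bot]
    refine ⟨.inl (EReal.coe_ne_bot _), .inr ((hg j).2 _).ne', .inl (EReal.coe_ne_top _),
      .inl (EReal.coe_nonneg.2 (hω j).le)⟩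
  · rw [h, EReal.coe_mul_top_of_pos (hω i)]

theorem IsPrimalOptimal.exists_eq_coe (hω : ∀ i, 0 < ω i) (hg : ∀ i, IsProper (g i))
    (hx : IsPrimalOptimal ω g K x) (hfeasible : ∃ x', ∀ i, K i x' ∈ dom (g i)) :
    ∃ r : Fin k → ℝ, ∀ i, g i (K i x) = r i := by
  obtain ⟨x', hx'⟩ := hfeasible
  choose s hs using fun i => (hg i).exists_eq_coe (hx' i)
  have hfinite : primalObj ω g K x < ⊤ :=
    (hx (mem_univ x')).trans_lt ((primalObj_eq hs).trans_lt (EReal.coe_lt_top _))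
  choose r hr using fun i => (hg i).exists_eq_coe (x := K i x)
    (lt_top_iff_ne_top.2 fun htop => hfinite.ne (primalObj_eq_top hω hg htop))
  exact ⟨r, hr⟩

theorem neg_mul_conj_add_le {E : Type*} [NormedAddCommGroup E] [InnerProductSpace ℝ E]
    (f : E → EReal) {c : ℝ} (hc : 0 < c) (u x : E) :
    -(c * conj f u) + ((c * inner ℝ u x : ℝ) : EReal) ≤ c * f x := by
  have hreal {t : ℝ} (ht : f x ≤ t) :
      -(c * conj f u) + ((c * inner ℝ u x : ℝ) : EReal) ≤ ((c * t : ℝ) : EReal) := by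
    have hmul := mul_le_mul_of_nonneg_left (inner_sub_le_conj ht u) (EReal.coe_nonneg.2 hc.le)
    refine (add_le_add_left (EReal.neg_le_neg_iff.2 hmul) _).trans (le_of_eq ?_)
    rw [← EReal.coe_mul, ← EReal.coe_neg, ← EReal.coe_add, EReal.coe_eq_coe_iff]
    ring
  induction hfx : f x with
  | top => simp [EReal.coe_mul_top_of_pos hc]
  | coe t => exact hreal hfx.le
  | bot =>
    rw [EReal.coe_mul_bot_of_pos hc, le_bot_iff, EReal.eq_bot_iff_forall_lt]
    intro t
    refine (hreal (t := c⁻¹ * (t - 1)) (by simp [hfx])).trans_lt ?_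
    rw [mul_inv_cancel_left₀ hc.ne']
    exact EReal.coe_lt_coe_iff.2 (sub_one_lt t)

variable [CompleteSpace X] [∀ i, CompleteSpace (Y i)]

theorem inner_sum_adjoint (ω : Fin k → ℝ) (K : ∀ i, X →L[ℝ] Y i) (y : ∀ i, Y i) (v : X) :
    inner ℝ (∑ i, ω i • (ContinuousLinearMap.adjoint (K i)) (y i)) v =
      ∑ i, ω i * inner ℝ (y i) (K i v) := by
  simp only [sum_inner, real_inner_smul_left, ContinuousLinearMap.adjoint_inner_left]

theorem sum_inner_eq_zero (hy : y ∈ dualFeasible ω K) (x : X) :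
    ∑ i, ω i * inner ℝ (y i) (K i x) = 0 := by
  rw [← inner_sum_adjoint, show ∑ i, ω i • (ContinuousLinearMap.adjoint (K i)) (y i) = 0 from hy,
    inner_zero_left]

theorem dualObj_le_primalObj (hω : ∀ i, 0 < ω i) (hy : y ∈ dualFeasible ω K) (x : X) :
    dualObj ω g y ≤ primalObj ω g K x :=
  calc dualObj ω g y
      = ∑ i, (-(ω i * conj (g i) (y i)) + ((ω i * inner ℝ (y i) (K i x) : ℝ) : EReal)) := by
        rw [Finset.sum_add_distrib, ← coe_finset_sum, sum_inner_eq_zero hy, EReal.coe_zero,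
          add_zero, dualObj]
    _ ≤ primalObj ω g K x :=
        Finset.sum_le_sum fun i _ => neg_mul_conj_add_le (g i) (hω i) (y i) (K i x)

/-- The optimality system `yᵢ ∈ ∂gᵢ(Kᵢ x)`, `∑ ωᵢ Kᵢ^* yᵢ = 0`, which certifies that `x` and `y`
solve the primal and the dual problem. -/
structure IsKuhnTucker (ω : Fin k → ℝ) (g : ∀ i, Y i → EReal) (K : ∀ i, X →L[ℝ] Y i)
    (x : X) (y : ∀ i, Y i) : Prop where
  mem_subdiff : ∀ i, y i ∈ subdiff (g i) (K i x)
  feasible : y ∈ dualFeasible ω K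

theorem IsKuhnTucker.primalObj_le_dualObj (hω : ∀ i, 0 < ω i) (h : IsKuhnTucker ω g K x y) :
    primalObj ω g K x ≤ dualObj ω g y := by
  choose r s hr hs hrs using fun i => mem_subdiff_iff_exists_add_le.1 (h.mem_subdiff i)
  refine (primalObj_le (fun i => (hω i).le) hr).trans
    (le_trans (EReal.coe_le_coe_iff.2 ?_) (le_dualObj (fun i => (hω i).le) hs))
  rw [← sub_nonneg, ← Finset.sum_sub_distrib, ← neg_nonpos, ← Finset.sum_neg_distrib,
    ← sum_inner_eq_zero h.feasible x]
  refine Finset.sum_le_sum fun i _ => ?_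
  linarith [mul_le_mul_of_nonneg_left (hrs i) (hω i).le]

theorem IsKuhnTucker.isPrimalOptimal (hω : ∀ i, 0 < ω i) (h : IsKuhnTucker ω g K x y) :
    IsPrimalOptimal ω g K x := fun x' _ =>
  (h.primalObj_le_dualObj hω).trans (dualObj_le_primalObj hω h.feasible x')

theorem IsKuhnTucker.isDualOptimal (hω : ∀ i, 0 < ω i) (h : IsKuhnTucker ω g K x y) :
    IsDualOptimal ω g K y :=
  ⟨h.feasible, fun _ hy' => (dualObj_le_primalObj hω hy' x).trans (h.primalObj_le_dualObj hω)⟩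

theorem IsKuhnTucker.primalValue_eq_dualValue (hω : ∀ i, 0 < ω i)
    (h : IsKuhnTucker ω g K x y) : primalValue ω g K = dualValue ω g K :=
  le_antisymm
    ((iInf_le _ x).trans ((h.primalObj_le_dualObj hω).trans (le_biSup (dualObj ω g) h.feasible)))
    (iSup₂_le fun _ hy' => le_iInf fun x' => dualObj_le_primalObj hω hy' x')

end Duality

section Qualification

variable {k : ℕ} {X : Type*} [NormedAddCommGroup X] [InnerProductSpace ℝ X]
  {Y : Fin k → Type*} [∀ i, NormedAddCommGroup (Y i)] [∀ i, InnerProductSpace ℝ (Y i)]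
  {ω : Fin k → ℝ} {g : ∀ i, Y i → EReal} {K : ∀ i, X →L[ℝ] Y i}

theorem QC1.qc2 (h : QC1 g K) : QC2 g K := by
  obtain ⟨x, hdom, hcont⟩ := h
  rw [QC2, mem_interior_iff_mem_nhds]
  have hnear (i : Fin k) : ∀ᶠ z : ∀ j, Y j in 𝓝 0, g i (z i + K i x) < ⊤ := by
    have hlim : Tendsto (fun z : ∀ j, Y j => z i + K i x) (𝓝 0) (𝓝 (K i x)) :=
      Continuous.tendsto' (by fun_prop) _ _ (zero_add _)
    exact hlim.eventually ((hcont i).eventually (Iio_mem_nhds (hdom i)))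
  filter_upwards [eventually_all.2 hnear] with z hz
  exact ⟨fun i => z i + K i x, fun i _ => hz i, x, by ext i; simp⟩

theorem QC2.qc3 (h : QC2 g K) : QC3 g K := by
  refine ⟨interior_subset h, ⊤, isClosed_univ, ?_⟩
  rw [Submodule.top_coe, eq_univ_iff_forall]
  intro z
  have hlim : Tendsto (fun t : ℝ => t • z) (𝓝[>] 0) (𝓝 0) :=
    tendsto_nhdsWithin_of_tendsto_nhds (Continuous.tendsto' (by fun_prop) _ _ (zero_smul ℝ z))
  obtain ⟨t, ht, ht0⟩ :=
    ((hlim.eventually (mem_interior_iff_mem_nhds.1 h)).and self_mem_nhdsWithin).exists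
  exact ⟨t⁻¹, inv_pos.2 ht0, t • z, ht, by rw [sub_zero, inv_smul_smul₀ (ne_of_gt ht0)]⟩

theorem exists_feasible_of_zero_mem_diffSet (h : 0 ∈ diffSet g K) :
    ∃ x, ∀ i, K i x ∈ dom (g i) := by
  obtain ⟨d, hd, x, hx⟩ := h
  refine ⟨x, fun i => ?_⟩
  have hKx : d i = K i x := sub_eq_zero.1 (congrFun hx i).symm
  exact hKx ▸ hd i (mem_univ i)

/-- The relation `gᵢ(Kᵢ x + zᵢ) ≤ rᵢ` between the variables `(x, r)` of the primal problem in
epigraph form and the perturbation `z`. -/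
def perturbedEpigraph (g : ∀ i, Y i → EReal) (K : ∀ i, X →L[ℝ] Y i) :
    Set ((X × (Fin k → ℝ)) × ∀ i, Y i) :=
  {q | ∀ i, g i (K i q.1.1 + q.2 i) ≤ q.1.2 i}

theorem convex_perturbedEpigraph (hconv : ∀ i, IsConvex (g i)) :
    Convex ℝ (perturbedEpigraph g K) := by
  intro q hq q' hq' a b ha hb hab i
  have hmem := hconv i (x := (K i q.1.1 + q.2 i, q.1.2 i)) (hq i)
    (y := (K i q'.1.1 + q'.2 i, q'.1.2 i)) (hq' i) ha hb hab
  have hpoint : K i (a • q + b • q').1.1 + (a • q + b • q').2 i =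
      a • (K i q.1.1 + q.2 i) + b • (K i q'.1.1 + q'.2 i) := by
    simp only [Prod.fst_add, Prod.smul_fst, Prod.snd_add, Prod.smul_snd, Pi.add_apply,
      Pi.smul_apply, map_add, map_smul, smul_add]
    abel
  rw [hpoint]
  exact hmem

theorem isClosed_perturbedEpigraph (hlsc : ∀ i, LowerSemicontinuous (g i)) :
    IsClosed (perturbedEpigraph g K) := by
  simp only [perturbedEpigraph, ofPred_forall]
  exact isClosed_iInter fun i => (isClosed_realEpigraph (hlsc i)).preimage
    (f := fun q : (X × (Fin k → ℝ)) × ∀ i, Y i => (K i q.1.1 + q.2 i, q.1.2 i)) (by fun_prop)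

theorem snd_image_perturbedEpigraph (hg : ∀ i, IsProper (g i)) :
    Prod.snd '' perturbedEpigraph g K = diffSet g K := by
  ext z
  constructor
  · rintro ⟨⟨⟨x, r⟩, z⟩, hz, rfl⟩
    exact ⟨fun i => K i x + z i, fun i _ => (hz i).trans_lt (EReal.coe_lt_top _), x, by ext; simp⟩
  · rintro ⟨d, hd, x, rfl⟩
    choose r hr using fun i => (hg i).exists_eq_coe (hd i (mem_univ i))
    exact ⟨((x, r), _), fun i => by simp [hr], rfl⟩

theorem exists_eq_sum_mul_inner {ι : Type*} [Fintype ι] {H : ι → Type*}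
    [∀ i, NormedAddCommGroup (H i)] [∀ i, InnerProductSpace ℝ (H i)] [∀ i, CompleteSpace (H i)]
    {c : ι → ℝ} (hc : ∀ i, c i ≠ 0) (l : (∀ i, H i) →L[ℝ] ℝ) :
    ∃ y : ∀ i, H i, ∀ z, l z = ∑ i, c i * inner ℝ (y i) (z i) := by
  classical
  refine ⟨fun i => (c i)⁻¹ • (InnerProductSpace.toDual ℝ (H i)).symm
    (l.comp (ContinuousLinearMap.single ℝ H i)), fun z => ?_⟩
  conv_lhs => rw [← Finset.univ_sum_single z, map_sum]
  refine Finset.sum_congr rfl fun i _ => ?_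
  rw [real_inner_smul_left, InnerProductSpace.toDual_symm_apply, mul_inv_cancel_left₀ (hc i)]
  rfl

variable [CompleteSpace X] [∀ i, CompleteSpace (Y i)]

theorem QC3.exists_multiplier (h : QC3 g K) (hω : ∀ i, 0 < ω i) (hg : ∀ i, IsProper (g i))
    (hconv : ∀ i, IsConvex (g i)) (hlsc : ∀ i, LowerSemicontinuous (g i)) {p : ℝ}
    (hp : ∀ x, (p : EReal) ≤ primalObj ω g K x) :
    ∃ y : ∀ i, Y i, ∀ (x : X) (z : ∀ i, Y i) (r : Fin k → ℝ),
      (∀ i, g i (K i x + z i) ≤ r i) →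
        p + ∑ i, ω i * inner ℝ (y i) (z i) ≤ ∑ i, ω i * r i := by
  let φ : X × (Fin k → ℝ) →L[ℝ] ℝ := ∑ i, ω i •
    (ContinuousLinearMap.proj i).comp (ContinuousLinearMap.snd ℝ X (Fin k → ℝ))
  have hφ (x : X) (r : Fin k → ℝ) : φ (x, r) = ∑ i, ω i * r i := by simp [φ]
  obtain ⟨l, hl⟩ := exists_multiplier_of_zero_mem_sqri (C := perturbedEpigraph g K)
    (convex_perturbedEpigraph hconv) (isClosed_perturbedEpigraph hlsc)
    (by rwa [snd_image_perturbedEpigraph hg]) φ (p := p) fun ⟨x, r⟩ hxr => by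
      rw [hφ, ← EReal.coe_le_coe_iff]
      exact (hp x).trans (primalObj_le (fun i => (hω i).le) fun i => by simpa using hxr i)
  obtain ⟨y, hy⟩ := exists_eq_sum_mul_inner (fun i => (hω i).ne') l
  refine ⟨y, fun x z r hr => ?_⟩
  rw [← hy, ← hφ x]
  exact hl (x, r) z hr

theorem isKuhnTucker_of_multiplier (hω : ∀ i, 0 < ω i) (hg : ∀ i, IsProper (g i)) {x : X}
    {r : Fin k → ℝ} (hr : ∀ i, g i (K i x) = r i) {y : ∀ i, Y i}
    (hy : ∀ (x' : X) (z : ∀ i, Y i) (r' : Fin k → ℝ), (∀ i, g i (K i x' + z i) ≤ r' i) →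
      ∑ i, ω i * r i + ∑ i, ω i * inner ℝ (y i) (z i) ≤ ∑ i, ω i * r' i) :
    IsKuhnTucker ω g K x y := by
  refine ⟨fun i => (mem_subdiff_iff_forall_le (hg i)).2 fun w t hwt => ?_, ?_⟩
  · have hle := hy x (Pi.single i (w - K i x)) (r + Pi.single i (t - r i)) fun j => by
      obtain rfl | hj := eq_or_ne j i
      · simpa using hwt
      · simpa [hj] using (hr j).le
    have hinner : ∑ j, ω j * inner ℝ (y j) (Pi.single i (w - K i x) j : Y j) =
        ω i * inner ℝ (y i) (w - K i x) := by
      rw [Finset.sum_eq_single_of_mem i (Finset.mem_univ i) fun j _ hj => by simp [hj],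
        Pi.single_eq_same]
    have hvalue : ∑ j, ω j * (r + Pi.single i (t - r i) : Fin k → ℝ) j =
        ∑ j, ω j * r j + ω i * (t - r i) := by
      simp [mul_add, Finset.sum_add_distrib, Pi.single_apply]
    rw [hinner, hvalue, add_le_add_iff_left, mul_le_mul_iff_right₀ (hω i)] at hle
    rw [hr i, EReal.coe_le_coe_iff]
    linarith
  · set v := ∑ i, ω i • (ContinuousLinearMap.adjoint (K i)) (y i) with hv
    have hle := hy (x - v) (fun i => K i v) r fun i => by simpa using (hr i).le
    rw [← inner_sum_adjoint, ← hv] at hle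
    exact (real_inner_self_nonpos (F := X)).1 (by linarith)

theorem QC3.exists_isKuhnTucker (h : QC3 g K) (hω : ∀ i, 0 < ω i) (hg : ∀ i, IsProper (g i))
    (hconv : ∀ i, IsConvex (g i)) (hlsc : ∀ i, LowerSemicontinuous (g i)) {x : X}
    (hx : IsPrimalOptimal ω g K x) : ∃ y, IsKuhnTucker ω g K x y := by
  obtain ⟨r, hr⟩ := hx.exists_eq_coe hω hg (exists_feasible_of_zero_mem_diffSet h.1)
  obtain ⟨y, hy⟩ := h.exists_multiplier hω hg hconv hlsc fun x' =>
    (primalObj_eq hr).symm.le.trans (hx (mem_univ x'))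
  exact ⟨y, isKuhnTucker_of_multiplier hω hg hr hy⟩

end Qualification

section ProximalPoint

variable {E : Type*} [NormedAddCommGroup E] [NormedSpace ℝ E] {B : E →L[ℝ] E →L[ℝ] ℝ}

theorem form_self_nonneg (hB : IsCoercive B) (v : E) : 0 ≤ B v v := by
  obtain ⟨C, hC, hle⟩ := hB
  exact le_trans (by positivity) (hle v)

theorem exists_norm_le_mul_sqrt_form (hB : IsCoercive B) :
    ∃ C, 0 ≤ C ∧ ∀ v, ‖v‖ ≤ C * √(B v v) := by
  obtain ⟨C, hC, hle⟩ := hB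
  refine ⟨(√C)⁻¹, by positivity, fun v => ?_⟩
  rw [le_inv_mul_iff₀ (by positivity), ← Real.sqrt_mul_self (norm_nonneg v),
    ← Real.sqrt_mul hC.le, ← mul_assoc]
  exact Real.sqrt_le_sqrt (hle v)

theorem tendsto_zero_of_tendsto_form {u : ℕ → E} (hB : IsCoercive B)
    (h : Tendsto (fun n => B (u n) (u n)) atTop (𝓝 0)) : Tendsto u atTop (𝓝 0) := by
  obtain ⟨C, -, hC⟩ := exists_norm_le_mul_sqrt_form hB
  exact squeeze_zero_norm (fun n => hC (u n)) (by simpa using h.sqrt.const_mul C)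

theorem tendsto_of_antitone_form_of_tendsto_subseq {u : ℕ → E} {v : E} (hB : IsCoercive B)
    (hanti : Antitone fun n => B (u n - v) (u n - v)) {φ : ℕ → ℕ} (hφ : StrictMono φ)
    (hlim : Tendsto (u ∘ φ) atTop (𝓝 v)) : Tendsto u atTop (𝓝 v) := by
  have hcont : Continuous fun w => B (w - v) (w - v) := by fun_prop
  have hsub : Tendsto (fun n => B (u (φ n) - v) (u (φ n) - v)) atTop (𝓝 0) := by
    simpa [Function.comp_def] using (hcont.tendsto v).comp hlim
  exact tendsto_sub_nhds_zero_iff.1 (tendsto_zero_of_tendsto_form hB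
    ((tendsto_iff_tendsto_subseq_of_antitone hanti hφ.tendsto_atTop).2 hsub))

theorem exists_tendsto_subseq_of_sub_mem {u : ℕ → E} {V : Submodule ℝ E} [FiniteDimensional ℝ V]
    (hV : ∀ n, u n - u 0 ∈ V) {p : E} {R : ℝ} (hR : ∀ n, ‖u n - p‖ ≤ R) :
    ∃ v, ∃ φ : ℕ → ℕ, StrictMono φ ∧ Tendsto (u ∘ φ) atTop (𝓝 v) := by
  have hbounded (n : ℕ) : (⟨u n - u 0, hV n⟩ : V) ∈ Metric.closedBall 0 (R + R) :=
    mem_closedBall_zero_iff.2 <|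
      calc ‖u n - u 0‖ = ‖u n - p - (u 0 - p)‖ := by rw [sub_sub_sub_cancel_right]
        _ ≤ R + R := (norm_sub_le _ _).trans (add_le_add (hR n) (hR 0))
  obtain ⟨v, -, φ, hφ, hlim⟩ := tendsto_subseq_of_bounded Metric.isBounded_closedBall hbounded
  refine ⟨v + u 0, φ, hφ, ?_⟩
  simpa [Function.comp_def] using
    ((continuous_subtype_val.tendsto v).comp hlim).add_const (u 0)

theorem form_sub_self_add_le (hsymm : ∀ v w, B v w = B w v) {u u' p : E}
    (h : 0 ≤ B (u - u') (u' - p)) :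
    B (u' - p) (u' - p) + B (u - u') (u - u') ≤ B (u - p) (u - p) := by
  rw [← sub_add_sub_cancel u u' p, map_add, map_add, add_apply, add_apply, hsymm (u' - p) (u - u')]
  linarith

theorem tendsto_zero_of_add_le {a b : ℕ → ℝ} (ha : ∀ n, 0 ≤ a n) (hb : ∀ n, 0 ≤ b n)
    (h : ∀ n, a (n + 1) + b n ≤ a n) : Tendsto b atTop (𝓝 0) := by
  have hanti : Antitone a := antitone_nat_of_succ_le fun n => by linarith [h n, hb n]
  have hlim := tendsto_atTop_ciInf hanti ⟨0, forall_mem_range.2 ha⟩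
  refine squeeze_zero hb (fun n => le_sub_iff_add_le'.2 (h n)) ?_
  simpa using hlim.sub (hlim.comp (tendsto_add_atTop_nat 1))

/- Monotonicity makes the iteration Fejér monotone with respect to the zeros of the relation; as the
steps tend to zero, every cluster point is such a zero. -/
theorem exists_tendsto_of_proximal_step {T : Set (E × E)} (hB : IsCoercive B)
    (hsymm : ∀ v w, B v w = B w v) (hT : IsClosed T)
    (hmono : ∀ p ∈ T, ∀ q ∈ T, 0 ≤ B (p.2 - q.2) (p.1 - q.1)) (hzero : ∃ z, (z, 0) ∈ T)
    {u : ℕ → E} (hu : ∀ n, (u (n + 1), u n - u (n + 1)) ∈ T) {V : Submodule ℝ E}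
    [FiniteDimensional ℝ V] (hV : ∀ n, u n - u 0 ∈ V) :
    ∃ z, (z, 0) ∈ T ∧ Tendsto u atTop (𝓝 z) := by
  have hstep {z : E} (hz : (z, 0) ∈ T) (n : ℕ) :
      B (u (n + 1) - z) (u (n + 1) - z) + B (u n - u (n + 1)) (u n - u (n + 1)) ≤
        B (u n - z) (u n - z) :=
    form_sub_self_add_le hsymm (by simpa using hmono _ (hu n) _ hz)
  have hanti {z : E} (hz : (z, 0) ∈ T) : Antitone fun n => B (u n - z) (u n - z) :=
    antitone_nat_of_succ_le fun n => le_of_add_le_of_nonneg_left (hstep hz n)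
      (form_self_nonneg hB _)
  obtain ⟨z, hz⟩ := hzero
  have hdiff : Tendsto (fun n => u n - u (n + 1)) atTop (𝓝 0) :=
    tendsto_zero_of_tendsto_form hB (tendsto_zero_of_add_le
      (fun n => form_self_nonneg hB (u n - z)) (fun n => form_self_nonneg hB _) (hstep hz))
  obtain ⟨C, hC, hnorm⟩ := exists_norm_le_mul_sqrt_form hB
  obtain ⟨v, φ, hφ, hlim⟩ := exists_tendsto_subseq_of_sub_mem hV fun n =>
    (hnorm (u n - z)).trans (mul_le_mul_of_nonneg_left
      (Real.sqrt_le_sqrt (hanti hz (Nat.zero_le n))) hC)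
  have hdiffsub := hdiff.comp hφ.tendsto_atTop
  have hsucc : Tendsto (fun n => u (φ n + 1)) atTop (𝓝 v) := by
    simpa [Function.comp_def] using hlim.sub hdiffsub
  have hv : (v, 0) ∈ T :=
    hT.mem_of_tendsto (hsucc.prodMk_nhds hdiffsub) (Eventually.of_forall fun n => hu (φ n))
  exact ⟨v, hv, tendsto_of_antitone_form_of_tendsto_subseq hB (hanti hv) hφ hlim⟩

end ProximalPoint

section Coercivity

theorem exists_pos_mul_norm_mul_norm_le {E ι : Type*} [Fintype ι] {F : ι → Type*}
    [SeminormedAddCommGroup E] [∀ i, SeminormedAddCommGroup (F i)] {a : ℝ} (ha : 0 < a) {b : ι → ℝ}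
    (hb : ∀ i, 0 < b i) :
    ∃ c, 0 < c ∧ ∀ v : E × ∀ i, F i, c * ‖v‖ * ‖v‖ ≤ a * ‖v.1‖ ^ 2 + ∑ i, b i * ‖v.2 i‖ ^ 2 := by
  have hsmall {t : ℝ} (ht : 0 < t) : ∀ᶠ c in 𝓝[>] (0 : ℝ), c ≤ t :=
    (eventually_le_nhds ht).filter_mono nhdsWithin_le_nhds
  obtain ⟨c, ⟨hca, hcb⟩, hc⟩ := (((hsmall ha).and (eventually_all.2 fun i => hsmall (hb i))).and
    self_mem_nhdsWithin).exists
  refine ⟨c, hc, fun v => ?_⟩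
  set G := a * ‖v.1‖ ^ 2 + ∑ i, b i * ‖v.2 i‖ ^ 2
  have hb0 (i : ι) : 0 ≤ b i * ‖v.2 i‖ ^ 2 := mul_nonneg (hb i).le (by positivity)
  have hfst : c * ‖v.1‖ ^ 2 ≤ G :=
    (mul_le_mul_of_nonneg_right hca (by positivity)).trans
      (le_add_of_nonneg_right (Finset.sum_nonneg fun i _ => hb0 i))
  have hG0 : 0 ≤ G := le_trans (by positivity) hfst
  have hsnd (i : ι) : c * ‖v.2 i‖ ^ 2 ≤ G :=
    (mul_le_mul_of_nonneg_right (hcb i) (by positivity)).trans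
      ((Finset.single_le_sum (fun j _ => hb0 j) (Finset.mem_univ i)).trans
        (le_add_of_nonneg_left (by positivity)))
  have hsqrt {t : ℝ} (ht : c * t ^ 2 ≤ G) : t ≤ √(G / c) :=
    Real.le_sqrt_of_sq_le ((le_div_iff₀' hc).2 ht)
  have hnorm : ‖v‖ ≤ √(G / c) :=
    max_le (hsqrt hfst) ((pi_norm_le_iff_of_nonneg (Real.sqrt_nonneg _)).2 fun i => hsqrt (hsnd i))
  rw [mul_assoc, ← pow_two, ← le_div_iff₀' hc, ← Real.sq_sqrt (div_nonneg hG0 hc.le)]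
  exact pow_le_pow_left₀ (norm_nonneg v) hnorm 2

theorem two_mul_inner_map_le {E F : Type*} [SeminormedAddCommGroup E] [NormedSpace ℝ E]
    [NormedAddCommGroup F] [InnerProductSpace ℝ F] (A : E →L[ℝ] F) {s : ℝ} (hs : 0 < s) (x : E)
    (y : F) : 2 * inner ℝ (A x) y ≤ s * ‖A‖ ^ 2 * ‖x‖ ^ 2 + s⁻¹ * ‖y‖ ^ 2 := by
  have hinner : inner ℝ (A x) y ≤ ‖A‖ * ‖x‖ * ‖y‖ :=
    (real_inner_le_norm _ _).trans (by gcongr; exact A.le_opNorm x)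
  have hyoung := two_mul_le_add_mul_sq (a := ‖A‖ * ‖x‖) (b := ‖y‖) hs
  linarith [mul_pow ‖A‖ ‖x‖ 2]

end Coercivity

section Iteration

variable {k : ℕ} {X : Type*} [NormedAddCommGroup X] [InnerProductSpace ℝ X]
  {Y : Fin k → Type*} [∀ i, NormedAddCommGroup (Y i)] [∀ i, InnerProductSpace ℝ (Y i)]
  {ω : Fin k → ℝ} {g : ∀ i, Y i → EReal} {K : ∀ i, X →L[ℝ] Y i} {σ τ : ℝ}

/-- The symmetric form with blocks `τ⁻¹`, `-K^*`, `-K`, `σ⁻¹`, weighted by `ω` in the dual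
variables. In the geometry it defines, the iteration is a proximal point iteration. -/
def primalDualForm (ω : Fin k → ℝ) (K : ∀ i, X →L[ℝ] Y i) (σ τ : ℝ) :
    (X × ∀ i, Y i) →L[ℝ] (X × ∀ i, Y i) →L[ℝ] ℝ :=
  let primal := ContinuousLinearMap.fst ℝ X (∀ i, Y i)
  let dual i := (ContinuousLinearMap.proj i).comp (ContinuousLinearMap.snd ℝ X (∀ i, Y i))
  let innerX := (isBoundedBilinearMap_inner (𝕜 := ℝ) (E := X)).toContinuousLinearMap
  let innerY i := (isBoundedBilinearMap_inner (𝕜 := ℝ) (E := Y i)).toContinuousLinearMap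
  τ⁻¹ • innerX.bilinearComp primal primal +
    ∑ i, ω i • (σ⁻¹ • (innerY i).bilinearComp (dual i) (dual i) -
      (innerY i).bilinearComp ((K i).comp primal) (dual i) -
      (innerY i).bilinearComp (dual i) ((K i).comp primal))

theorem primalDualForm_apply (v w : X × ∀ i, Y i) :
    primalDualForm ω K σ τ v w = τ⁻¹ * inner ℝ v.1 w.1 +
      ∑ i, ω i * (σ⁻¹ * inner ℝ (v.2 i) (w.2 i) - inner ℝ (K i v.1) (w.2 i) -
        inner ℝ (v.2 i) (K i w.1)) := by
  simp [primalDualForm]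

theorem primalDualForm_comm (v w : X × ∀ i, Y i) :
    primalDualForm ω K σ τ v w = primalDualForm ω K σ τ w v := by
  simp only [primalDualForm_apply]
  rw [real_inner_comm]
  refine congrArg _ (Finset.sum_congr rfl fun i _ => ?_)
  rw [real_inner_comm (v.2 i), real_inner_comm (w.2 i) (K i v.1), real_inner_comm (K i w.1)]
  ring

theorem le_primalDualForm_self (hω : ∀ i, 0 ≤ ω i) {s : ℝ} (hs : 0 < s) (v : X × ∀ i, Y i) :
    (τ⁻¹ - s * ∑ i, ω i * ‖K i‖ ^ 2) * ‖v.1‖ ^ 2 + ∑ i, ω i * (σ⁻¹ - s⁻¹) * ‖v.2 i‖ ^ 2 ≤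
      primalDualForm ω K σ τ v v := by
  rw [primalDualForm_apply, real_inner_self_eq_norm_sq, sub_mul, sub_add_eq_add_sub,
    add_sub_assoc, add_le_add_iff_left, mul_assoc, Finset.sum_mul, Finset.mul_sum,
    ← Finset.sum_sub_distrib]
  refine Finset.sum_le_sum fun i _ => ?_
  rw [real_inner_self_eq_norm_sq, real_inner_comm (K i v.1) (v.2 i)]
  linarith [mul_le_mul_of_nonneg_left (two_mul_inner_map_le (K i) hs v.1 (v.2 i)) (hω i)]

theorem isCoercive_primalDualForm (hω : ∀ i, 0 < ω i) (hσ : 0 < σ) (hτ : 0 < τ)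
    (hστ : σ * τ * ∑ i, ω i * ‖K i‖ ^ 2 < 1) : IsCoercive (primalDualForm ω K σ τ) := by
  set N := ∑ i, ω i * ‖K i‖ ^ 2
  obtain ⟨s, hsN, hσs⟩ : ∃ s, s * τ * N < 1 ∧ σ < s := by
    have hcont : Continuous fun s : ℝ => s * τ * N := by fun_prop
    exact (((hcont.tendsto σ).mono_left nhdsWithin_le_nhds).eventually_lt_const hστ |>.and
      (self_mem_nhdsWithin (s := Ioi σ))).exists
  have hprimal : 0 < τ⁻¹ - s * N := by
    rwa [sub_pos, ← one_div, lt_div_iff₀ hτ, mul_right_comm]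
  have hdual (i : Fin k) : 0 < ω i * (σ⁻¹ - s⁻¹) :=
    mul_pos (hω i) (sub_pos.2 (inv_strictAnti₀ hσ hσs))
  obtain ⟨c, hc, hle⟩ := exists_pos_mul_norm_mul_norm_le (E := X) (F := Y) hprimal hdual
  exact ⟨c, hc, fun v => (hle v).trans
    (le_primalDualForm_self (fun i => (hω i).le) (hσ.trans hσs) v)⟩

variable [CompleteSpace X] [∀ i, CompleteSpace (Y i)]

/-- The monotone operator `(x, y) ↦ (∑ ωᵢ Kᵢ^* yᵢ, ∂gᵢ^*(yᵢ) - Kᵢ x)` of the optimality system,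
encoded as the set of pairs `(v, d)` such that `primalDualForm ω K σ τ d` represents one of its
values at `v`. -/
def primalDualRelation (ω : Fin k → ℝ) (g : ∀ i, Y i → EReal) (K : ∀ i, X →L[ℝ] Y i) (σ τ : ℝ) :
    Set ((X × ∀ i, Y i) × (X × ∀ i, Y i)) :=
  {p | τ⁻¹ • p.2.1 = ∑ i, ω i • (ContinuousLinearMap.adjoint (K i)) (p.1.2 i + p.2.2 i) ∧
    ∀ i, σ⁻¹ • p.2.2 i - K i p.2.1 + K i p.1.1 ∈ subdiff (conj (g i)) (p.1.2 i)}

theorem isClosed_primalDualRelation (hconj : ∀ i, IsProper (conj (g i))) :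
    IsClosed (primalDualRelation ω g K σ τ) := by
  refine IsClosed.and (isClosed_eq (by fun_prop) (by fun_prop)) ?_
  simp only [ofPred_forall]
  exact isClosed_iInter fun i =>
    (isClosed_graph_subdiff (hconj i) (lowerSemicontinuous_conj (g i))).preimage
      (f := fun p : (X × ∀ i, Y i) × (X × ∀ i, Y i) =>
        (p.1.2 i, σ⁻¹ • p.2.2 i - K i p.2.1 + K i p.1.1)) (by fun_prop)

theorem primalDualForm_nonneg_of_mem_primalDualRelation (hω : ∀ i, 0 ≤ ω i)
    {p q : (X × ∀ i, Y i) × (X × ∀ i, Y i)} (hp : p ∈ primalDualRelation ω g K σ τ)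
    (hq : q ∈ primalDualRelation ω g K σ τ) :
    0 ≤ primalDualForm ω K σ τ (p.2 - q.2) (p.1 - q.1) := by
  have hprimal : τ⁻¹ * inner ℝ (p.2.1 - q.2.1) (p.1.1 - q.1.1) =
      ∑ i, ω i * inner ℝ (p.1.2 i + p.2.2 i - (q.1.2 i + q.2.2 i)) (K i (p.1.1 - q.1.1)) := by
    rw [← inner_sum_adjoint, ← real_inner_smul_left, smul_sub, hp.1, hq.1]
    simp only [map_sub, smul_sub, Finset.sum_sub_distrib]
  rw [primalDualForm_apply, Prod.fst_sub, Prod.fst_sub, hprimal, ← Finset.sum_add_distrib]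
  refine Finset.sum_nonneg fun i _ => ?_
  have hcross (w : Y i) : inner ℝ (p.1.2 i + p.2.2 i - (q.1.2 i + q.2.2 i)) w =
      inner ℝ w (p.1.2 i - q.1.2 i) + inner ℝ (p.2.2 i - q.2.2 i) w := by
    rw [add_sub_add_comm, inner_add_left, real_inner_comm w]
  have hdual : σ⁻¹ • p.2.2 i - K i p.2.1 + K i p.1.1 - (σ⁻¹ • q.2.2 i - K i q.2.1 + K i q.1.1) =
      σ⁻¹ • (p.2.2 i - q.2.2 i) - K i (p.2.1 - q.2.1) + K i (p.1.1 - q.1.1) := by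
    simp only [map_sub, smul_sub]
    abel
  have hmono := inner_sub_nonneg_of_mem_subdiff (hp.2 i) (hq.2 i)
  rw [hdual, inner_add_left, inner_sub_left, real_inner_smul_left] at hmono
  rw [hcross, ← mul_add]
  refine mul_nonneg (hω i) (hmono.trans_eq ?_)
  simp only [Prod.snd_sub, Pi.sub_apply]
  ring

theorem mk_zero_mem_primalDualRelation_iff (hg : ∀ i, (dom (g i)).Nonempty)
    (hconv : ∀ i, IsConvex (g i)) (hlsc : ∀ i, LowerSemicontinuous (g i)) {z : X × ∀ i, Y i} :
    (z, 0) ∈ primalDualRelation ω g K σ τ ↔ IsKuhnTucker ω g K z.1 z.2 := by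
  simp only [primalDualRelation, mem_ofPred_eq, Prod.fst_zero, Prod.snd_zero, Pi.zero_apply,
    smul_zero, map_zero, sub_zero, zero_add, add_zero,
    mem_subdiff_conj_iff (hg _) (hconv _) (hlsc _)]
  exact ⟨fun h => ⟨h.2, h.1.symm⟩, fun h => ⟨h.feasible.symm, h.mem_subdiff⟩⟩

/-- The pairs `(xⁿ, yⁿ⁺¹)`: with this shift the extrapolated points disappear from the recursion. -/
def shiftedIter (ω : Fin k → ℝ) (g : ∀ i, Y i → EReal) (K : ∀ i, X →L[ℝ] Y i) (σ τ : ℝ)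
    (x0 : X) (y0 : ∀ i, Y i) (n : ℕ) : X × ∀ i, Y i :=
  ((iter ω g K σ τ x0 y0 n).x, (iter ω g K σ τ x0 y0 (n + 1)).y)

variable {x0 : X} {y0 : ∀ i, Y i}

theorem shiftedIter_succ_fst (n : ℕ) :
    (shiftedIter ω g K σ τ x0 y0 (n + 1)).1 = (shiftedIter ω g K σ τ x0 y0 n).1 -
      τ • ∑ i, ω i • (ContinuousLinearMap.adjoint (K i)) ((shiftedIter ω g K σ τ x0 y0 n).2 i) :=
  rfl

theorem shiftedIter_succ_snd (n : ℕ) (i : Fin k) :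
    (shiftedIter ω g K σ τ x0 y0 (n + 1)).2 i = prox σ (conj (g i))
      ((shiftedIter ω g K σ τ x0 y0 n).2 i + σ • K i ((2 : ℝ) •
        (shiftedIter ω g K σ τ x0 y0 (n + 1)).1 - (shiftedIter ω g K σ τ x0 y0 n).1)) :=
  rfl

theorem shiftedIter_mem_primalDualRelation [∀ i, FiniteDimensional ℝ (Y i)]
    (hg : ∀ i, (dom (g i)).Nonempty) (hconj : ∀ i, IsProper (conj (g i))) (hσ : 0 < σ)
    (hτ : 0 < τ) (n : ℕ) :
    (shiftedIter ω g K σ τ x0 y0 (n + 1),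
      shiftedIter ω g K σ τ x0 y0 n - shiftedIter ω g K σ τ x0 y0 (n + 1)) ∈
        primalDualRelation ω g K σ τ := by
  set u := shiftedIter ω g K σ τ x0 y0 with hu
  refine ⟨?_, fun i => ?_⟩
  · have hstep : (u (n + 1)).1 =
        (u n).1 - τ • ∑ i, ω i • (ContinuousLinearMap.adjoint (K i)) ((u n).2 i) :=
      shiftedIter_succ_fst n
    simp only [Prod.fst_sub, Prod.snd_sub, Pi.sub_apply, add_sub_cancel]
    rw [hstep, sub_sub_cancel, inv_smul_smul₀ hτ.ne']
  · have hdom : (dom (conj (conj (g i)))).Nonempty :=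
      (hg i).mono fun y hy => (conj_conj_le (g i) y).trans_lt hy
    have hprox := prox_mem_subdiff (hconj i) (isConvex_conj (g i)) (lowerSemicontinuous_conj (g i))
      hdom hσ ((u n).2 i + σ • K i ((2 : ℝ) • (u (n + 1)).1 - (u n).1))
    rw [← shiftedIter_succ_snd] at hprox
    convert hprox using 1
    simp only [Prod.fst_sub, Prod.snd_sub, Pi.sub_apply, map_sub, map_smul, ← hu]
    rw [add_sub_right_comm, smul_add, inv_smul_smul₀ hσ.ne', two_smul]
    abel

theorem shiftedIter_sub_mem (n : ℕ) :
    shiftedIter ω g K σ τ x0 y0 n - shiftedIter ω g K σ τ x0 y0 0 ∈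
      (⨆ i, (ContinuousLinearMap.adjoint (K i)).range).prod ⊤ := by
  refine ⟨?_, trivial⟩
  induction n with
  | zero => simp
  | succ n ih =>
    rw [Prod.fst_sub, shiftedIter_succ_fst, sub_right_comm]
    refine sub_mem ih (Submodule.smul_mem _ _ (Submodule.sum_smul_mem _ _ fun i _ => ?_))
    exact Submodule.mem_iSup_of_mem i (LinearMap.mem_range_self _ _)

theorem exists_tendsto_iter [∀ i, FiniteDimensional ℝ (Y i)] (hω : ∀ i, 0 < ω i)
    (hg : ∀ i, IsProper (g i)) (hconv : ∀ i, IsConvex (g i))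
    (hlsc : ∀ i, LowerSemicontinuous (g i)) (hsol : ∃ x y, IsKuhnTucker ω g K x y) (hσ : 0 < σ)
    (hτ : 0 < τ) (hστ : σ * τ * ∑ i, ω i * ‖K i‖ ^ 2 < 1) (x0 : X) (y0 : ∀ i, Y i) :
    ∃ x y, IsKuhnTucker ω g K x y ∧
      Tendsto (fun n => (iter ω g K σ τ x0 y0 n).x) atTop (𝓝 x) ∧
      Tendsto (fun n => (iter ω g K σ τ x0 y0 n).y) atTop (𝓝 y) := by
  have hdom (i : Fin k) : (dom (g i)).Nonempty := (hg i).1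
  have hzero (z : X × ∀ i, Y i) :
      (z, 0) ∈ primalDualRelation ω g K σ τ ↔ IsKuhnTucker ω g K z.1 z.2 :=
    mk_zero_mem_primalDualRelation_iff hdom hconv hlsc
  obtain ⟨xs, ys, hs⟩ := hsol
  have hconj (i : Fin k) : IsProper (conj (g i)) :=
    isProper_conj (hg i) ⟨ys i, lt_top_iff_ne_top.2
      ((mem_subdiff_conj_iff (hdom i) (hconv i) (hlsc i)).2 (hs.mem_subdiff i)).1⟩
  have hfinite : FiniteDimensional ℝ ((⨆ i, (ContinuousLinearMap.adjoint (K i)).range).prod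
      (⊤ : Submodule ℝ (∀ i, Y i))) :=
    Module.Finite.iff_fg.2 ((Module.Finite.iff_fg.1 inferInstance).prod
      (Module.Finite.iff_fg.1 inferInstance))
  obtain ⟨z, hz, hlim⟩ := exists_tendsto_of_proximal_step
    (isCoercive_primalDualForm hω hσ hτ hστ) primalDualForm_comm
    (isClosed_primalDualRelation hconj)
    (fun p hp q hq => primalDualForm_nonneg_of_mem_primalDualRelation (fun i => (hω i).le) hp hq)
    ⟨(xs, ys), (hzero _).2 hs⟩ (shiftedIter_mem_primalDualRelation hdom hconj hσ hτ)
    (shiftedIter_sub_mem (x0 := x0) (y0 := y0))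
  exact ⟨z.1, z.2, (hzero z).1 hz, (continuous_fst.tendsto z).comp hlim,
    (tendsto_add_atTop_iff_nat 1).1 ((continuous_snd.tendsto z).comp hlim)⟩

end Iteration

end PrimalDual

end

theorem theorem18_general {k : ℕ}
    {X : Type*} [NormedAddCommGroup X] [InnerProductSpace ℝ X] [CompleteSpace X]
    {Y : Fin k → Type*} [∀ i, NormedAddCommGroup (Y i)] [∀ i, InnerProductSpace ℝ (Y i)]
    [∀ i, CompleteSpace (Y i)]
    (ω : Fin k → ℝ) (hω : ∀ i, 0 < ω i)
    (g : ∀ i, Y i → EReal) (hproper : ∀ i, PrimalDual.IsProper (g i))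
    (hconvex : ∀ i, PrimalDual.IsConvex (g i)) (hlsc : ∀ i, LowerSemicontinuous (g i))
    (K : ∀ i, X →L[ℝ] Y i)
    (xhat : X) (hxhat : PrimalDual.IsPrimalOptimal ω g K xhat)
    (hQC : PrimalDual.QC1 g K ∨ PrimalDual.QC2 g K ∨ PrimalDual.QC3 g K) :
    (∃ yhat : ∀ i, Y i,
      PrimalDual.IsDualOptimal ω g K yhat ∧
      PrimalDual.primalValue ω g K = PrimalDual.dualValue ω g K ∧
      (∀ i, K i xhat ∈ PrimalDual.subdiff (PrimalDual.conj (g i)) (yhat i)) ∧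
      ∑ i, ω i • (ContinuousLinearMap.adjoint (K i)) (yhat i) = 0) ∧
    ((∀ i, FiniteDimensional ℝ (Y i)) →
      ∀ σ τ : ℝ, 0 < σ → 0 < τ → σ * τ * ∑ i, ω i * ‖K i‖ ^ 2 < 1 →
      ∀ (x0 : X) (y0 : ∀ i, Y i),
        (∃ xstar : X, PrimalDual.IsPrimalOptimal ω g K xstar ∧
          Tendsto (fun n => (PrimalDual.iter ω g K σ τ x0 y0 n).x) atTop (𝓝 xstar)) ∧
        (∃ ystar : ∀ i, Y i, PrimalDual.IsDualOptimal ω g K ystar ∧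
          Tendsto (fun n => (PrimalDual.iter ω g K σ τ x0 y0 n).y) atTop (𝓝 ystar))) := by
  have hQC3 : PrimalDual.QC3 g K := by
    rcases hQC with h | h | h
    exacts [h.qc2.qc3, h.qc3, h]
  obtain ⟨yhat, hKT⟩ := hQC3.exists_isKuhnTucker hω hproper hconvex hlsc hxhat
  refine ⟨⟨yhat, hKT.isDualOptimal hω, hKT.primalValue_eq_dualValue hω, fun i => ?_,
    hKT.feasible⟩, fun _ σ τ hσ hτ hστ x0 y0 => ?_⟩
  · exact (PrimalDual.mem_subdiff_conj_iff (hproper i).1 (hconvex i) (hlsc i)).2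
      (hKT.mem_subdiff i)
  · obtain ⟨x, y, hxy, hx, hy⟩ := PrimalDual.exists_tendsto_iter hω hproper hconvex hlsc
      ⟨xhat, yhat, hKT⟩ hσ hτ hστ x0 y0
    exact ⟨⟨x, hxy.isPrimalOptimal hω, hx⟩, ⟨y, hxy.isDualOptimal hω, hy⟩⟩

theorem theorem18 {k : ℕ}
    {X : Type*} [NormedAddCommGroup X] [InnerProductSpace ℝ X] [CompleteSpace X]
    {Y : Fin k → Type*} [∀ i, NormedAddCommGroup (Y i)] [∀ i, InnerProductSpace ℝ (Y i)]
    [∀ i, CompleteSpace (Y i)]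
    (ω : Fin k → ℝ) (hω : ∀ i, 0 < ω i ∧ ω i ≤ 1) (hωsum : ∑ i, ω i = 1)
    (g : ∀ i, Y i → EReal) (hproper : ∀ i, PrimalDual.IsProper (g i))
    (hconvex : ∀ i, PrimalDual.IsConvex (g i)) (hlsc : ∀ i, LowerSemicontinuous (g i))
    (K : ∀ i, X →L[ℝ] Y i)
    (xhat : X) (hxhat : PrimalDual.IsPrimalOptimal ω g K xhat)
    (hQC : PrimalDual.QC1 g K ∨ PrimalDual.QC2 g K ∨ PrimalDual.QC3 g K) :
    (∃ yhat : ∀ i, Y i,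
      PrimalDual.IsDualOptimal ω g K yhat ∧
      PrimalDual.primalValue ω g K = PrimalDual.dualValue ω g K ∧
      (∀ i, K i xhat ∈ PrimalDual.subdiff (PrimalDual.conj (g i)) (yhat i)) ∧
      ∑ i, ω i • (ContinuousLinearMap.adjoint (K i)) (yhat i) = 0) ∧
    (FiniteDimensional ℝ X → (∀ i, FiniteDimensional ℝ (Y i)) →
      ∀ σ τ : ℝ, 0 < σ → 0 < τ → σ * τ * ∑ i, ‖K i‖ ^ 2 < 1 →
      ∀ (x0 : X) (y0 : ∀ i, Y i),
        (∃ xstar : X, PrimalDual.IsPrimalOptimal ω g K xstar ∧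
          Tendsto (fun n => (PrimalDual.iter ω g K σ τ x0 y0 n).x) atTop (𝓝 xstar)) ∧
        (∃ ystar : ∀ i, Y i, PrimalDual.IsDualOptimal ω g K ystar ∧
          Tendsto (fun n => (PrimalDual.iter ω g K σ τ x0 y0 n).y) atTop (𝓝 ystar))) := by
  obtain ⟨hdual, hlim⟩ := theorem18_general ω (fun i => (hω i).1) g hproper hconvex hlsc K xhat
    hxhat hQC
  refine ⟨hdual, fun _ hY σ τ hσ hτ hστ => hlim hY σ τ hσ hτ (lt_of_le_of_lt ?_ hστ)⟩
  gcongr with i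
  exact mul_le_of_le_one_left (by positivity) (hω i).2
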